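/- Let $d\ge 1$ and let $\Omega\subset\mathbb R^d$ be a bounded open set with smooth boundary. Let $H^1(\Omega)$ carry the norm $\|y\|_{H^1(\Omega)}=(\|y\|_{L^2(\Omega)}^2+\|\nabla y\|_{L^2(\Omega)}^2)^{1/2}$, let $H^1_0(\Omega)$ be the closure of $C_c^\infty(\Omega)$ in $H^1(\Omega)$ with the norm $\|\varphi\|_{H^1_0(\Omega)}:=\|\nabla\varphi\|_{L^2(\Omega)}$, and let $H^{-1}(\Omega)=(H^1_0(\Omega))'$ carry the corresponding dual norm. Let $H^{1/2}(\partial\Omega)\subset L^2(\partial\Omega)$ be the space of traces $y_{|\partial\Omega}$ of functions $y\in H^1(\Omega)$, with the norm $\|g\|_{H^{1/2}(\partial\Omega)}=\inf\{\|y\|_{H^1(\Omega)} : y\in H^1(\Omega),\ y_{|\partial\Omega}=g\}$. Let $M>m>0$, let $L^\infty_F(\Omega)$ be any linear subspace (for instance a finite-dimensional one) of $L^\infty(\Omega)$, and put $$\mathcal U_{m,M}=\{u\in L^\infty_F(\Omega) : m\le u(x)\le M \text{ for a.e. } x\in\Omega\}.$$ Let $f\in H^{-1}(\Omega)$ and $g\in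 H^{1/2}(\partial\Omega)$. Then for every $u\in\mathcal U_{m,M}$ there is exactly one $y=\mathbb S(u)\in H^1(\Omega)$ with $-\operatorname{div}(u\nabla y)=f$ in $H^{-1}(\Omega)$, that is, $\int_\Omega u\nabla y\cdot\nabla\varphi\,dx=\langle f,\varphi\rangle$ for all $\varphi\in H^1_0(\Omega)$, and $y_{|\partial\Omega}=g$. For all $u_1,u_2\in\mathcal U_{m,M}$ the solutions $y_1=\mathbb S(u_1)$ and $y_2=\mathbb S(u_2)$ satisfy $y_1-y_2\in H^1_0(\Omega)$ and $$\|y_1-y_2\|_{H^1_0(\Omega)}\le\frac1{m^2}\,\|u_1-u_2\|_{L^\infty(\Omega)}\left(\|f\|_{H^{-1}(\Omega)}+M\|g\|_{H^{1/2}(\partial\Omega)}\right).$$ In particular, the control-to-state map $\mathbb S:\mathcal U_{m,M}\to H^1(\Omega)$, with the $L^\infty(\Omega)$ distance on $\mathcal U_{m,M}$, is Lipschitz continuous. -/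

import Mathlib

open MeasureTheory Filter Topology Set
open scoped ENNReal NNReal ContDiff

namespace Conductivity

noncomputable section

/-- The Euclidean space `ℝ^d`. -/
abbrev E (d : ℕ) : Type := EuclideanSpace ℝ (Fin d)

/-- A bounded open set with smooth boundary: near each boundary point, `Ω` is the
sublevel set `{ρ < 0}` of a smooth function whose differential does not vanish at that point. -/
structure IsSmoothBoundedOpen {d : ℕ} (Ω : Set (E d)) : Prop where
  isOpen : IsOpen Ω
  isBounded : Bornology.IsBounded Ω
  smooth_boundary : ∀ x ∈ frontier Ω, ∃ (V : Set (E d)) (ρ : E d → ℝ),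
    IsOpen V ∧ x ∈ V ∧ ContDiffOn ℝ ∞ ρ V ∧ fderiv ℝ ρ x ≠ 0 ∧
      Ω ∩ V = {z ∈ V | ρ z < 0}

/-- `L²(Ω)`. -/
abbrev L2 {d : ℕ} (Ω : Set (E d)) := Lp ℝ 2 (volume.restrict Ω)

/-- `L²(Ω; ℝ^d)`. -/
abbrev L2Vec {d : ℕ} (Ω : Set (E d)) := Lp (E d) 2 (volume.restrict Ω)

/-- `L^∞(Ω)`. -/
abbrev LInf {d : ℕ} (Ω : Set (E d)) := Lp ℝ ∞ (volume.restrict Ω)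

/-- `φ ∈ C_c^∞(Ω)`. -/
structure IsTest {d : ℕ} (Ω : Set (E d)) (φ : E d → ℝ) : Prop where
  contDiff : ContDiff ℝ ∞ φ
  hasCompactSupport : HasCompactSupport φ
  tsupport_subset : tsupport φ ⊆ Ω

/-- `G` is the weak gradient of `y` on `Ω`. -/
def IsWeakGradient {d : ℕ} {Ω : Set (E d)} (y : L2 Ω) (G : L2Vec Ω) : Prop :=
  ∀ φ : E d → ℝ, IsTest Ω φ → ∀ v : E d,
    ∫ x in Ω, y x * fderiv ℝ φ x v = - ∫ x in Ω, inner ℝ (G x) v * φ x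

lemma integrable_mul_fderiv {d : ℕ} {Ω : Set (E d)} (y : L2 Ω) {φ : E d → ℝ}
    (h : IsTest Ω φ) (v : E d) :
    Integrable (fun x => y x * fderiv ℝ φ x v) (volume.restrict Ω) := by
  have hc : Continuous fun x => fderiv ℝ φ x v :=
    (h.contDiff.continuous_fderiv (by simp)).clm_apply continuous_const
  have hs : HasCompactSupport fun x => fderiv ℝ φ x v := h.hasCompactSupport.fderiv_apply ℝ v
  exact (Lp.memLp y).integrable_mul (hc.memLp_of_hasCompactSupport (p := 2) hs)

lemma integrable_inner_mul {d : ℕ} {Ω : Set (E d)} (G : L2Vec Ω) {φ : E d → ℝ}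
    (h : IsTest Ω φ) (v : E d) :
    Integrable (fun x => inner ℝ (G x) v * φ x) (volume.restrict Ω) :=
  ((Lp.memLp G).inner_const v).integrable_mul
    (h.contDiff.continuous.memLp_of_hasCompactSupport (p := 2) h.hasCompactSupport)

/-- The Sobolev space `H¹(Ω)`, each element being stored together with its (unique) weak
gradient. The ambient space carries the norm `(‖y‖²_{L²} + ‖∇y‖²_{L²})^{1/2}`. -/
def H1 {d : ℕ} (Ω : Set (E d)) : Submodule ℝ (WithLp 2 (L2 Ω × L2Vec Ω)) where
  carrier := {w | IsWeakGradient w.fst w.snd}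
  zero_mem' := by
    intro φ _ v
    have h1 : ∀ᵐ x ∂(volume.restrict Ω), ((0 : L2 Ω) x) * fderiv ℝ φ x v = 0 := by
      filter_upwards [Lp.coeFn_zero ℝ 2 (volume.restrict Ω)] with x hx
      rw [hx, Pi.zero_apply, zero_mul]
    have h2 : ∀ᵐ x ∂(volume.restrict Ω), inner ℝ ((0 : L2Vec Ω) x) v * φ x = 0 := by
      filter_upwards [Lp.coeFn_zero (E d) 2 (volume.restrict Ω)] with x hx
      rw [hx, Pi.zero_apply, inner_zero_left, zero_mul]
    have e1 := integral_congr_ae h1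
    have e2 := integral_congr_ae h2
    simp only [integral_zero] at e1 e2
    simp only [WithLp.zero_fst, WithLp.zero_snd]
    rw [e1, e2, neg_zero]
  add_mem' := by
    intro a b ha hb φ hφ v
    have h1 : ∀ᵐ x ∂(volume.restrict Ω), ((a.fst + b.fst : L2 Ω) x) * fderiv ℝ φ x v
        = a.fst x * fderiv ℝ φ x v + b.fst x * fderiv ℝ φ x v := by
      filter_upwards [Lp.coeFn_add a.fst b.fst] with x hx
      rw [hx, Pi.add_apply, add_mul]
    have h2 : ∀ᵐ x ∂(volume.restrict Ω), inner ℝ ((a.snd + b.snd : L2Vec Ω) x) v * φ x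
        = inner ℝ (a.snd x) v * φ x + inner ℝ (b.snd x) v * φ x := by
      filter_upwards [Lp.coeFn_add a.snd b.snd] with x hx
      rw [hx, Pi.add_apply, inner_add_left, add_mul]
    have e1 := integral_congr_ae h1
    have e2 := integral_congr_ae h2
    simp only [WithLp.add_fst, WithLp.add_snd]
    rw [e1, e2, integral_add (integrable_mul_fderiv _ hφ v) (integrable_mul_fderiv _ hφ v),
      integral_add (integrable_inner_mul _ hφ v) (integrable_inner_mul _ hφ v),
      ha φ hφ v, hb φ hφ v]
    ring
  smul_mem' := by
    intro c a ha φ hφ v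
    have h1 : ∀ᵐ x ∂(volume.restrict Ω), ((c • a.fst : L2 Ω) x) * fderiv ℝ φ x v
        = c * (a.fst x * fderiv ℝ φ x v) := by
      filter_upwards [Lp.coeFn_smul c a.fst] with x hx
      rw [hx, Pi.smul_apply, smul_eq_mul, mul_assoc]
    have h2 : ∀ᵐ x ∂(volume.restrict Ω), inner ℝ ((c • a.snd : L2Vec Ω) x) v * φ x
        = c * (inner ℝ (a.snd x) v * φ x) := by
      filter_upwards [Lp.coeFn_smul c a.snd] with x hx
      rw [hx, Pi.smul_apply, real_inner_smul_left, mul_assoc]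
    have e1 := integral_congr_ae h1
    have e2 := integral_congr_ae h2
    simp only [WithLp.smul_fst, WithLp.smul_snd]
    rw [e1, e2, integral_const_mul, integral_const_mul, ha φ hφ v]
    ring

/-- The function underlying an element of `H¹(Ω)`. -/
def fn {d : ℕ} {Ω : Set (E d)} (y : H1 Ω) : L2 Ω := (y : WithLp 2 (L2 Ω × L2Vec Ω)).fst

/-- The weak gradient of an element of `H¹(Ω)`. -/
def grad {d : ℕ} {Ω : Set (E d)} (y : H1 Ω) : L2Vec Ω := (y : WithLp 2 (L2 Ω × L2Vec Ω)).snd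

/-- `C_c^∞(Ω)` as a subspace of `H¹(Ω)`. -/
def testH1 {d : ℕ} (Ω : Set (E d)) : Submodule ℝ (H1 Ω) where
  carrier := {w | ∃ φ : E d → ℝ, IsTest Ω φ ∧ fn w =ᵐ[volume.restrict Ω] φ}
  zero_mem' := by
    refine ⟨0, ⟨contDiff_const, HasCompactSupport.zero, ?_⟩, Lp.coeFn_zero _ _ _⟩
    rw [tsupport_eq_empty_iff.2 rfl]
    exact empty_subset _
  add_mem' := by
    rintro a b ⟨φ, hφ, ha⟩ ⟨ψ, hψ, hb⟩
    refine ⟨φ + ψ, ⟨hφ.contDiff.add hψ.contDiff, hφ.hasCompactSupport.add hψ.hasCompactSupport,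
      (tsupport_add φ ψ).trans (union_subset hφ.tsupport_subset hψ.tsupport_subset)⟩, ?_⟩
    exact (Lp.coeFn_add (fn a) (fn b)).trans (ha.add hb)
  smul_mem' := by
    rintro c a ⟨φ, hφ, ha⟩
    refine ⟨c • φ, ⟨contDiff_const.smul hφ.contDiff, hφ.hasCompactSupport.smul_left (f := fun _ => c),
      (tsupport_smul_subset_right (fun _ => c) φ).trans hφ.tsupport_subset⟩, ?_⟩
    exact (Lp.coeFn_smul c (fn a)).trans (ha.const_smul c)

/-- `H¹₀(Ω)`: the closure of `C_c^∞(Ω)` in `H¹(Ω)`. -/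
def H10 {d : ℕ} (Ω : Set (E d)) : Submodule ℝ (H1 Ω) := (testH1 Ω).topologicalClosure

/-- `‖w‖_{H¹₀(Ω)} = ‖∇w‖_{L²(Ω)}`. -/
def h10Norm {d : ℕ} {Ω : Set (E d)} (w : H1 Ω) : ℝ := ‖grad w‖

/-- `H⁻¹(Ω)`, the topological dual of `H¹₀(Ω)`. -/
abbrev HNeg1 {d : ℕ} (Ω : Set (E d)) := StrongDual ℝ (H10 Ω)

/-- The norm of `H⁻¹(Ω)` dual to the norm `‖∇·‖_{L²(Ω)}` of `H¹₀(Ω)`: the least `C ≥ 0` with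
`|⟨f, φ⟩| ≤ C ‖∇φ‖_{L²(Ω)}` for all `φ ∈ H¹₀(Ω)`. -/
def hNeg1Norm {d : ℕ} {Ω : Set (E d)} (f : HNeg1 Ω) : ℝ :=
  sInf {C : ℝ | 0 ≤ C ∧ ∀ φ : H10 Ω, |f φ| ≤ C * h10Norm (φ : H1 Ω)}

/-- The surface measure of `∂Ω`: the `(d-1)`-dimensional Hausdorff measure restricted to `∂Ω`
(Mathlib's normalization of Hausdorff measure only changes it by a constant factor). -/
def surface {d : ℕ} (Ω : Set (E d)) : Measure (E d) :=
  (Measure.hausdorffMeasure ((d : ℝ) - 1)).restrict (frontier Ω)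

/-- `L²(∂Ω)`. -/
abbrev L2Bdry {d : ℕ} (Ω : Set (E d)) := Lp ℝ 2 (surface Ω)

/-- `h ∈ L²(∂Ω)` is the trace `y_{|∂Ω}` of `y ∈ H¹(Ω)`: there are functions `φ n`, smooth up to the
boundary, converging to `y` in `H¹(Ω)` whose restrictions to `∂Ω` converge to `h` in `L²(∂Ω)`.
This is the graph of the continuous extension to `H¹(Ω)` of the restriction `φ ↦ φ_{|∂Ω}`. -/
def HasTrace {d : ℕ} {Ω : Set (E d)} (y : H1 Ω) (h : L2Bdry Ω) : Prop :=
  ∃ (φ : ℕ → E d → ℝ) (w : ℕ → H1 Ω),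
    (∀ n, ContDiff ℝ ∞ (φ n) ∧ HasCompactSupport (φ n)) ∧
    (∀ n, fn (w n) =ᵐ[volume.restrict Ω] φ n) ∧
    Tendsto w atTop (𝓝 y) ∧
    Tendsto (fun n => eLpNorm (fun x => φ n x - h x) 2 (surface Ω)) atTop (𝓝 0)

/-- `g ∈ H^{1/2}(∂Ω)`: `g` is the trace of some element of `H¹(Ω)`. -/
def MemH12 {d : ℕ} {Ω : Set (E d)} (g : L2Bdry Ω) : Prop := ∃ y : H1 Ω, HasTrace y g

/-- The norm of `H^{1/2}(∂Ω)`: the infimum of `‖y‖_{H¹(Ω)}` over all `y ∈ H¹(Ω)` with trace `g`. -/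
def h12Norm {d : ℕ} {Ω : Set (E d)} (g : L2Bdry Ω) : ℝ :=
  sInf {r : ℝ | ∃ y : H1 Ω, HasTrace y g ∧ r = ‖y‖}

/-- The admissible conductivities: the `u` in the subspace `F` of `L^∞(Ω)` with `m ≤ u ≤ M` a.e. -/
def U {d : ℕ} {Ω : Set (E d)} (F : Submodule ℝ (LInf Ω)) (m M : ℝ) : Set (LInf Ω) :=
  {u | u ∈ F ∧ ∀ᵐ x ∂(volume.restrict Ω), m ≤ u x ∧ u x ≤ M}

/-- `y ∈ H¹(Ω)` solves `-div(u∇y) = f` in `H⁻¹(Ω)` and `y = g` on `∂Ω`. -/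
def IsSolution {d : ℕ} {Ω : Set (E d)} (u : LInf Ω) (f : HNeg1 Ω) (g : L2Bdry Ω) (y : H1 Ω) :
    Prop :=
  (∀ φ : H10 Ω, ∫ x in Ω, u x * inner ℝ (grad y x) (grad (φ : H1 Ω) x) = f φ) ∧ HasTrace y g

end

end Conductivity

namespace Conductivity

noncomputable section

variable {d : ℕ} {Ω : Set (E d)}

-- Write δ = y₁ - y₂. Subtracting the two equations and testing with δ, which lies in `H10 Ω`, gives
-- m‖∇δ‖ ≤ ‖u₁ - u₂‖ ‖∇y₂‖, so it suffices to show m‖∇y₂‖ ≤ ‖f‖ + M‖g‖. For this y₂ is split as w +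
-- h, where w ∈ `H10 Ω` carries the source f and h solves the homogeneous equation with the same
-- boundary values. Testing with w gives m‖∇w‖ ≤ ‖f‖; by Dirichlet's principle h has least energy
-- among all extensions z of the boundary data, whence m‖∇h‖ ≤ M‖∇z‖. Existence is Lax–Milgram with
-- Poincaré's inequality, and uniqueness is the case u₁ = u₂. This part is pure Hilbert space
-- theory: `norm_solution_le`, `norm_sub_solution_le`, `exists_lipschitz_solution_map`.
--
-- The analytic input is that functions with equal traces differ by an element of `H10 Ω`
-- (`HasTrace.sub_mem_H10`). The difference is a limit of smooth φₙ with boundary values tending to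
-- zero. The boundary term ∫_Ω ∂ᵥ(φₙψ) is bounded by those values through the fundamental theorem of
-- calculus on lines transversal to ∂Ω (`exists_measure_integral_fderiv_le`), so in the limit the
-- extension by zero has a weak gradient on the whole space (`hasZeroExtension_of_tendsto`). Such a
-- function, cut into small pieces, is mollified with kernels shifted towards the inside of Ω, which
-- yields approximating test functions (`exists_push`, `HasZeroExtension.mem_H10`).

local instance : NormedAddCommGroup (H1 Ω) := inferInstance

set_option synthInstance.maxHeartbeats 200000 in
local instance : InnerProductSpace ℝ (H1 Ω) := inferInstance

local instance : NormedSpace ℝ (H1 Ω) := inferInstance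

local instance : NormedAddCommGroup (H10 Ω) := inferInstance

set_option synthInstance.maxHeartbeats 200000 in
local instance : InnerProductSpace ℝ (H10 Ω) := inferInstance

local instance : NormedSpace ℝ (H10 Ω) := inferInstance

/-! ### The Hilbert space H¹(Ω): norms, test functions, completeness. -/

lemma norm_sq_eq (y : H1 Ω) : ‖y‖ ^ 2 = ‖fn y‖ ^ 2 + ‖grad y‖ ^ 2 :=
  WithLp.prod_norm_sq_eq_of_L2 (y : WithLp 2 (L2 Ω × L2Vec Ω))

lemma norm_fn_le (y : H1 Ω) : ‖fn y‖ ≤ ‖y‖ := by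
  refine abs_le_of_sq_le_sq' ?_ (norm_nonneg _) |>.2
  rw [norm_sq_eq]; nlinarith [sq_nonneg ‖grad y‖]

lemma norm_grad_le (y : H1 Ω) : ‖grad y‖ ≤ ‖y‖ := by
  refine abs_le_of_sq_le_sq' ?_ (norm_nonneg _) |>.2
  rw [norm_sq_eq]; nlinarith [sq_nonneg ‖fn y‖]

/-- The function part of an `H¹` element, as a continuous linear map. -/
def fnL : H1 Ω →L[ℝ] L2 Ω :=
  LinearMap.mkContinuous ⟨⟨fn, fun _ _ => rfl⟩, fun _ _ => rfl⟩ 1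
    fun y => (norm_fn_le y).trans_eq (one_mul _).symm

/-- The weak gradient as a continuous linear map. -/
def gradL : H1 Ω →L[ℝ] L2Vec Ω :=
  LinearMap.mkContinuous ⟨⟨grad, fun _ _ => rfl⟩, fun _ _ => rfl⟩ 1
    fun y => (norm_grad_le y).trans_eq (one_mul _).symm

@[simp] lemma gradL_apply (y : H1 Ω) : gradL y = grad y := rfl

lemma fn_add (y z : H1 Ω) : fn (y + z) = fn y + fn z := rfl

lemma fn_sub (y z : H1 Ω) : fn (y - z) = fn y - fn z := rfl

lemma grad_sub (y z : H1 Ω) : grad (y - z) = grad y - grad z := rfl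

lemma H1.ext_fn_grad {y z : H1 Ω} (h₁ : fn y = fn z) (h₂ : grad y = grad z) : y = z := by
  rw [← sub_eq_zero, ← norm_eq_zero, ← sq_eq_zero_iff, norm_sq_eq]
  have e₁ : fn (y - z) = 0 := by rw [fn_sub, h₁, sub_self]
  have e₂ : grad (y - z) = 0 := by rw [grad_sub, h₂, sub_self]
  simp [e₁, e₂]

lemma IsTest.to_univ {φ : E d → ℝ} (h : IsTest Ω φ) : IsTest univ φ :=
  ⟨h.contDiff, h.hasCompactSupport, subset_univ _⟩

lemma IsTest.continuous {φ : E d → ℝ} (h : IsTest Ω φ) : Continuous φ := h.contDiff.continuous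

lemma IsTest.differentiable {φ : E d → ℝ} (h : IsTest Ω φ) : Differentiable ℝ φ :=
  h.contDiff.differentiable (by simp)

lemma IsTest.continuous_fderiv_apply {φ : E d → ℝ} (h : IsTest Ω φ) (v : E d) :
    Continuous fun x => fderiv ℝ φ x v :=
  (h.contDiff.continuous_fderiv (by simp)).clm_apply continuous_const

lemma IsTest.memLp {φ : E d → ℝ} (h : IsTest Ω φ) (p : ℝ≥0∞) (μ : Measure (E d))
    [IsFiniteMeasureOnCompacts μ] : MemLp φ p μ :=
  h.continuous.memLp_of_hasCompactSupport h.hasCompactSupport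

lemma IsTest.memLp_smul_const {φ : E d → ℝ} (h : IsTest Ω φ) (v : E d) (p : ℝ≥0∞)
    (μ : Measure (E d)) [IsFiniteMeasureOnCompacts μ] : MemLp (fun x => φ x • v) p μ :=
  (h.continuous.smul continuous_const).memLp_of_hasCompactSupport h.hasCompactSupport.smul_right

lemma IsTest.memLp_fderiv {φ : E d → ℝ} (h : IsTest Ω φ) (v : E d) (p : ℝ≥0∞) (μ : Measure (E d))
    [IsFiniteMeasureOnCompacts μ] : MemLp (fun x => fderiv ℝ φ x v) p μ :=
  (h.continuous_fderiv_apply v).memLp_of_hasCompactSupport (h.hasCompactSupport.fderiv_apply ℝ v)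

lemma IsTest.mul_left {φ ψ : E d → ℝ} (h : IsTest Ω φ) (hψ : ContDiff ℝ ∞ ψ) :
    IsTest Ω (fun x => ψ x * φ x) where
  contDiff := hψ.mul h.contDiff
  hasCompactSupport := h.hasCompactSupport.mul_left
  tsupport_subset := (tsupport_mul_subset_right (f := ψ)).trans h.tsupport_subset

lemma IsTest.mul_right {φ ψ : E d → ℝ} (h : IsTest Ω φ) (hψ : ContDiff ℝ ∞ ψ) :
    IsTest Ω (fun x => φ x * ψ x) where
  contDiff := h.contDiff.mul hψ
  hasCompactSupport := h.hasCompactSupport.mul_right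
  tsupport_subset := (tsupport_mul_subset_left (g := ψ)).trans h.tsupport_subset

lemma IsTest.add {φ ψ : E d → ℝ} (h : IsTest Ω φ) (hψ : IsTest Ω ψ) :
    IsTest Ω (fun x => φ x + ψ x) where
  contDiff := h.contDiff.add hψ.contDiff
  hasCompactSupport := h.hasCompactSupport.add hψ.hasCompactSupport
  tsupport_subset := (tsupport_add φ ψ).trans (union_subset h.tsupport_subset hψ.tsupport_subset)

lemma IsTest.neg {φ : E d → ℝ} (h : IsTest Ω φ) : IsTest Ω (fun x => -φ x) where
  contDiff := h.contDiff.neg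
  hasCompactSupport := h.hasCompactSupport.neg
  tsupport_subset := by
    have : tsupport (fun x => -φ x) = tsupport φ := tsupport_neg φ
    exact this ▸ h.tsupport_subset

lemma fderiv_mul_apply {φ ψ : E d → ℝ} (hφ : Differentiable ℝ φ) (hψ : Differentiable ℝ ψ)
    (x v : E d) :
    fderiv ℝ (fun x => φ x * ψ x) x v = φ x * fderiv ℝ ψ x v + fderiv ℝ φ x v * ψ x := by
  rw [fderiv_fun_mul (hφ x) (hψ x)]
  simp [mul_comm]

/-- The classical gradient represents the derivative. -/
lemma inner_gradient (φ : E d → ℝ) (x v : E d) : inner ℝ (gradient φ x) v = fderiv ℝ φ x v := by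
  simp [gradient]

lemma IsTest.continuous_gradient {φ : E d → ℝ} (h : IsTest Ω φ) : Continuous (gradient φ) :=
  (InnerProductSpace.toDual ℝ (E d)).symm.continuous.comp
    (h.contDiff.continuous_fderiv (by simp))

lemma IsTest.hasCompactSupport_gradient {φ : E d → ℝ} (h : IsTest Ω φ) :
    HasCompactSupport (gradient φ) :=
  (h.hasCompactSupport.fderiv ℝ).comp_left (map_zero (InnerProductSpace.toDual ℝ (E d)).symm)

lemma IsTest.memLp_gradient {φ : E d → ℝ} (h : IsTest Ω φ) (p : ℝ≥0∞) (μ : Measure (E d))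
    [IsFiniteMeasureOnCompacts μ] : MemLp (gradient φ) p μ :=
  h.continuous_gradient.memLp_of_hasCompactSupport h.hasCompactSupport_gradient

/-- The defect of the integration by parts formula for `y` against `ψ` in the direction `v`. -/
def weakDefect (ψ : E d → ℝ) (v : E d) (y : L2 Ω) (G : L2Vec Ω) : ℝ :=
  (∫ x in Ω, y x * fderiv ℝ ψ x v) + ∫ x in Ω, inner ℝ (G x) v * ψ x

lemma isWeakGradient_iff {y : L2 Ω} {G : L2Vec Ω} :
    IsWeakGradient y G ↔ ∀ φ, IsTest Ω φ → ∀ v, weakDefect φ v y G = 0 := by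
  simp only [IsWeakGradient, weakDefect, add_eq_zero_iff_eq_neg]

lemma IsTest.integrable_mul_fderiv {ψ : E d → ℝ} (h : IsTest univ ψ) (y : L2 Ω) (v : E d) :
    Integrable (fun x => y x * fderiv ℝ ψ x v) (volume.restrict Ω) :=
  (Lp.memLp y).integrable_mul (h.memLp_fderiv v 2 _)

lemma IsTest.integrable_inner_mul {ψ : E d → ℝ} (h : IsTest univ ψ) (G : L2Vec Ω) (v : E d) :
    Integrable (fun x => inner ℝ (G x) v * ψ x) (volume.restrict Ω) :=
  ((Lp.memLp G).inner_const v).integrable_mul (h.memLp 2 _)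

/-- As a pairing with fixed L² elements, the defect is continuous in the pair (y, G). Here ψ need
not vanish near ∂Ω: with ψ supported in Ω this makes H¹(Ω) closed, and with general ψ it lets
boundary terms pass to the limit. -/
lemma weakDefect_eq_inner {ψ : E d → ℝ} (h : IsTest univ ψ) (v : E d) (y : L2 Ω) (G : L2Vec Ω) :
    weakDefect ψ v y G =
      inner ℝ ((h.memLp_fderiv v 2 (volume.restrict Ω)).toLp _) y +
        inner ℝ ((h.memLp_smul_const v 2 (volume.restrict Ω)).toLp _) G := by
  rw [L2.inner_def, L2.inner_def, weakDefect]
  congr 1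
  · refine integral_congr_ae ?_
    filter_upwards [(h.memLp_fderiv v 2 (volume.restrict Ω)).coeFn_toLp] with x hx
    rw [hx]; rfl
  · refine integral_congr_ae ?_
    filter_upwards [(h.memLp_smul_const v 2 (volume.restrict Ω)).coeFn_toLp] with x hx
    rw [hx, real_inner_smul_left, real_inner_comm, mul_comm]

lemma continuous_weakDefect {ψ : E d → ℝ} (h : IsTest univ ψ) (v : E d) :
    Continuous fun w : WithLp 2 (L2 Ω × L2Vec Ω) => weakDefect ψ v w.fst w.snd := by
  simp_rw [weakDefect_eq_inner h]
  fun_prop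

lemma isClosed_H1 : IsClosed (H1 Ω : Set (WithLp 2 (L2 Ω × L2Vec Ω))) := by
  have : (H1 Ω : Set (WithLp 2 (L2 Ω × L2Vec Ω))) =
      ⋂ (φ : E d → ℝ) (_ : IsTest Ω φ) (v : E d), {w | weakDefect φ v w.fst w.snd = 0} := by
    ext w
    simp only [mem_iInter, mem_ofPred_eq]
    exact isWeakGradient_iff
  rw [this]
  exact isClosed_iInter fun φ => isClosed_iInter fun h => isClosed_iInter fun v =>
    isClosed_singleton.preimage (continuous_weakDefect h.to_univ v)

instance : CompleteSpace (H1 Ω) := isClosed_H1.completeSpace_coe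

instance : CompleteSpace (H10 Ω) :=
  (Submodule.isClosed_topologicalClosure (testH1 Ω)).completeSpace_coe

/-! ### Smooth functions in H¹(Ω) and uniqueness of weak gradients. -/

/-- Integration by parts on the whole space. -/
lemma integral_fderiv_mul_add {φ ψ : E d → ℝ} (hφ : Differentiable ℝ φ)
    (hφ' : ∀ v, Continuous fun x => fderiv ℝ φ x v) (hψ : IsTest Ω ψ) (v : E d) :
    ∫ x, φ x * fderiv ℝ ψ x v = -∫ x, fderiv ℝ φ x v * ψ x := by
  refine integral_mul_fderiv_eq_neg_fderiv_mul_of_integrable ?_ ?_ ?_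
    (fun x _ => hφ x) (fun x _ => hψ.differentiable x)
  · exact ((hφ' v).mul hψ.continuous).integrable_of_hasCompactSupport
      hψ.hasCompactSupport.mul_left
  · exact (hφ.continuous.mul (hψ.continuous_fderiv_apply v)).integrable_of_hasCompactSupport
      (hψ.hasCompactSupport.fderiv_apply ℝ v).mul_left
  · exact (hφ.continuous.mul hψ.continuous).integrable_of_hasCompactSupport
      hψ.hasCompactSupport.mul_left

lemma IsTest.eq_zero_of_notMem {ψ : E d → ℝ} (hψ : IsTest Ω ψ) {x : E d} (hx : x ∉ Ω) : ψ x = 0 :=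
  image_eq_zero_of_notMem_tsupport fun h => hx (hψ.tsupport_subset h)

lemma IsTest.fderiv_eq_zero_of_notMem {ψ : E d → ℝ} (hψ : IsTest Ω ψ) {x : E d} (hx : x ∉ Ω) :
    fderiv ℝ ψ x = 0 :=
  image_eq_zero_of_notMem_tsupport fun h => hx (hψ.tsupport_subset (tsupport_fderiv_subset ℝ h))

/-- A smooth compactly supported function as an element of `H¹(Ω)`. -/
def IsTest.toH1 {φ : E d → ℝ} (h : IsTest univ φ) (Ω : Set (E d)) : H1 Ω :=
  ⟨WithLp.toLp 2 ((h.memLp 2 (volume.restrict Ω)).toLp φ,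
    (h.memLp_gradient 2 (volume.restrict Ω)).toLp _), by
    intro ψ hψ v
    change ∫ x in Ω, (h.memLp 2 (volume.restrict Ω)).toLp φ x * fderiv ℝ ψ x v =
      -∫ x in Ω, inner ℝ ((h.memLp_gradient 2 (volume.restrict Ω)).toLp _ x) v * ψ x
    have e₁ : ∫ x in Ω, (h.memLp 2 (volume.restrict Ω)).toLp φ x * fderiv ℝ ψ x v =
        ∫ x in Ω, φ x * fderiv ℝ ψ x v := by
      refine integral_congr_ae ?_
      filter_upwards [(h.memLp 2 (volume.restrict Ω)).coeFn_toLp] with x hx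
      rw [hx]
    have e₂ : ∫ x in Ω, inner ℝ ((h.memLp_gradient 2 (volume.restrict Ω)).toLp _ x) v * ψ x =
        ∫ x in Ω, fderiv ℝ φ x v * ψ x := by
      refine integral_congr_ae ?_
      filter_upwards [(h.memLp_gradient 2 (volume.restrict Ω)).coeFn_toLp] with x hx
      rw [hx, inner_gradient]
    rw [e₁, e₂,
      setIntegral_eq_integral_of_forall_compl_eq_zero fun x hx => by
        rw [hψ.fderiv_eq_zero_of_notMem hx]; simp,
      setIntegral_eq_integral_of_forall_compl_eq_zero fun x hx => by
        rw [hψ.eq_zero_of_notMem hx]; simp]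
    exact integral_fderiv_mul_add h.differentiable h.continuous_fderiv_apply hψ v⟩

lemma IsTest.fn_toH1 {φ : E d → ℝ} (h : IsTest univ φ) :
    fn (h.toH1 Ω) =ᵐ[volume.restrict Ω] φ := (h.memLp 2 (volume.restrict Ω)).coeFn_toLp

lemma IsTest.grad_toH1 {φ : E d → ℝ} (h : IsTest univ φ) :
    grad (h.toH1 Ω) =ᵐ[volume.restrict Ω] gradient φ :=
  (h.memLp_gradient 2 (volume.restrict Ω)).coeFn_toLp

/-- Weak gradients are unique. -/
lemma grad_eq_of_fn_eq (hΩ : IsOpen Ω) {y z : H1 Ω} (h : fn y = fn z) : grad y = grad z := by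
  suffices H : ∀ w : H1 Ω, fn w = 0 → grad w = 0 by
    have := H (y - z) (by rw [fn_sub, h, sub_self])
    exact sub_eq_zero.1 this
  intro w hw
  have hloc : LocallyIntegrableOn (grad w) Ω volume :=
    locallyIntegrableOn_of_locallyIntegrable_restrict
      ((Lp.memLp (grad w)).locallyIntegrable (by norm_num))
  refine Lp.eq_zero_iff_ae_eq_zero.2 ((ae_restrict_iff' hΩ.measurableSet).2 ?_)
  refine hΩ.ae_eq_zero_of_integral_contDiff_smul_eq_zero hloc fun ψ h₁ h₂ h₃ => ?_
  have hψ : IsTest Ω ψ := ⟨h₁, h₂, h₃⟩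
  rw [← setIntegral_eq_integral_of_forall_compl_eq_zero (s := Ω) fun x hx => by
    rw [hψ.eq_zero_of_notMem hx, zero_smul]]
  have hint : Integrable (fun x => ψ x • grad w x) (volume.restrict Ω) :=
    memLp_one_iff_integrable.1 ((Lp.memLp (grad w)).smul (hψ.memLp 2 (volume.restrict Ω)))
  refine ext_inner_left ℝ fun v => ?_
  rw [inner_zero_right, ← integral_inner hint]
  have h0 : ∫ x in Ω, fn w x * fderiv ℝ ψ x v = 0 := by
    rw [hw]
    refine integral_eq_zero_of_ae ?_
    filter_upwards [Lp.coeFn_zero ℝ 2 (volume.restrict Ω)] with x hx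
    rw [hx]; simp
  have hw' := w.2 ψ hψ v
  change ∫ x in Ω, fn w x * fderiv ℝ ψ x v = -∫ x in Ω, inner ℝ (grad w x) v * ψ x at hw'
  rw [h0, eq_comm, neg_eq_zero] at hw'
  rw [← hw']
  refine integral_congr_ae (ae_of_all _ fun x => ?_)
  change inner ℝ v (ψ x • grad w x) = inner ℝ (grad w x) v * ψ x
  rw [real_inner_smul_right, real_inner_comm, mul_comm]

/-- `testH1` and `HasTrace` prescribe only the function part of an element; uniqueness of weak
gradients shows that the gradient is then the classical one. -/
lemma eq_toH1 (hΩ : IsOpen Ω) {φ : E d → ℝ} (h : IsTest univ φ) {w : H1 Ω}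
    (hw : fn w =ᵐ[volume.restrict Ω] φ) : w = h.toH1 Ω :=
  have e : fn w = fn (h.toH1 Ω) := Lp.ext (hw.trans h.fn_toH1.symm)
  H1.ext_fn_grad e (grad_eq_of_fn_eq hΩ e)

lemma IsTest.toH1_mem_testH1 {φ : E d → ℝ} (h : IsTest Ω φ) : h.to_univ.toH1 Ω ∈ testH1 Ω :=
  ⟨φ, h, h.to_univ.fn_toH1⟩

/-! ### Poincaré's inequality. -/

/-- Poincaré's inequality for test functions. -/
lemma norm_fn_toH1_le (hΩ : MeasurableSet Ω) {R : ℝ} (hR0 : 0 ≤ R)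
    (hR : ∀ x ∈ Ω, ‖x‖ ≤ R) {e : E d}
    (he : ‖e‖ = 1) {φ : E d → ℝ} (h : IsTest Ω φ) :
    ‖fn (h.to_univ.toH1 Ω)‖ ≤ 2 * R * ‖grad (h.to_univ.toH1 Ω)‖ := by
  set w := h.to_univ.toH1 Ω
  have hw : fn w =ᵐ[volume.restrict Ω] φ := h.to_univ.fn_toH1
  have hg : grad w =ᵐ[volume.restrict Ω] gradient φ := h.to_univ.grad_toH1
  -- The coordinate ℓ has derivative 1 along e, so integration by parts gives ∫ φ² = -2 ∫ ℓ φ ∂ₑφ.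
  -- Since |ℓ| ≤ R on Ω, Cauchy–Schwarz yields the constant 2R.
  let ℓ : E d →L[ℝ] ℝ := innerSL ℝ e
  have hℓ : ∀ x, ℓ x = inner ℝ e x := fun x => rfl
  have hA : IsTest Ω (fun x => ℓ x * φ x) := h.mul_left ℓ.contDiff
  set A : L2 Ω := (hA.memLp 2 (volume.restrict Ω)).toLp _
  set B : L2 Ω := (h.memLp_fderiv e 2 (volume.restrict Ω)).toLp _
  have hA' : A =ᵐ[volume.restrict Ω] fun x => ℓ x * φ x := MemLp.coeFn_toLp _
  have hB' : B =ᵐ[volume.restrict Ω] fun x => fderiv ℝ φ x e := MemLp.coeFn_toLp _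
  have nA : ‖A‖ ≤ R * ‖fn w‖ := by
    refine Lp.norm_le_mul_norm_of_ae_le_mul ?_
    filter_upwards [hA', hw, ae_restrict_mem hΩ] with x h1 h2 h3
    rw [h1, h2, norm_mul]
    gcongr
    calc ‖ℓ x‖ ≤ ‖e‖ * ‖x‖ := norm_inner_le_norm (𝕜 := ℝ) e x
      _ ≤ R := by rw [he, one_mul]; exact hR x h3
  have nB : ‖B‖ ≤ ‖grad w‖ := by
    refine Lp.norm_le_norm_of_ae_le ?_
    filter_upwards [hB', hg] with x h1 h2
    rw [h1, h2, ← inner_gradient]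
    simpa [he] using norm_inner_le_norm (𝕜 := ℝ) (gradient φ x) e
  have key : ∫ x, φ x * φ x = -(2 * ∫ x, (ℓ x * φ x) * fderiv ℝ φ x e) := by
    have hφφ : IsTest Ω (fun x => φ x * φ x) := h.mul_left h.contDiff
    have := integral_fderiv_mul_add (φ := ℓ) ℓ.differentiable
      (fun v => by simpa using continuous_const) hφφ e
    have e1 : ∀ x, fderiv ℝ ℓ x e * (φ x * φ x) = φ x * φ x := fun x => by
      rw [ContinuousLinearMap.fderiv, hℓ, real_inner_self_eq_norm_sq, he]; ring
    have e2 : ∀ x, ℓ x * fderiv ℝ (fun x => φ x * φ x) x e =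
        2 * ((ℓ x * φ x) * fderiv ℝ φ x e) := fun x => by
      rw [fderiv_mul_apply h.differentiable h.differentiable]; ring
    simp_rw [e1, e2] at this
    rw [integral_const_mul] at this
    linarith
  have i1 : inner ℝ (fn w) (fn w) = ∫ x, φ x * φ x := by
    have hz : ∀ x ∉ Ω, φ x * φ x = 0 := fun x hx => by rw [h.eq_zero_of_notMem hx, zero_mul]
    rw [L2.inner_def, ← setIntegral_eq_integral_of_forall_compl_eq_zero hz]
    refine integral_congr_ae ?_
    filter_upwards [hw] with x hx
    rw [hx]; rfl
  have i2 : inner ℝ B A = ∫ x, (ℓ x * φ x) * fderiv ℝ φ x e := by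
    have hz : ∀ x ∉ Ω, (ℓ x * φ x) * fderiv ℝ φ x e = 0 := fun x hx => by
      rw [h.eq_zero_of_notMem hx, mul_zero, zero_mul]
    rw [L2.inner_def, ← setIntegral_eq_integral_of_forall_compl_eq_zero hz]
    refine integral_congr_ae ?_
    filter_upwards [hA', hB'] with x h1 h2
    rw [h1, h2]; rfl
  rw [← i1, ← i2, real_inner_self_eq_norm_sq] at key
  have cs : -inner ℝ B A ≤ ‖B‖ * ‖A‖ :=
    (neg_le_abs _).trans (abs_real_inner_le_norm B A)
  have : ‖fn w‖ ^ 2 ≤ (2 * R * ‖grad w‖) * ‖fn w‖ := by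
    have : ‖B‖ * ‖A‖ ≤ ‖grad w‖ * (R * ‖fn w‖) := by gcongr
    linarith
  rcases (norm_nonneg (fn w)).eq_or_lt with h0 | h0
  · rw [← h0]
    positivity
  · rw [sq] at this
    exact le_of_mul_le_mul_right this h0

/-- Poincaré's inequality. -/
lemma exists_norm_fn_le (hd : 1 ≤ d) (hΩ : IsOpen Ω) (hb : Bornology.IsBounded Ω) :
    ∃ C : ℝ, 0 ≤ C ∧ ∀ w ∈ H10 Ω, ‖fn w‖ ≤ C * ‖grad w‖ := by
  obtain ⟨R, hR0, hR⟩ := hb.exists_pos_norm_le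
  refine ⟨2 * R, by positivity, ?_⟩
  have hcl : IsClosed {w : H1 Ω | ‖fn w‖ ≤ 2 * R * ‖grad w‖} :=
    isClosed_le fnL.continuous.norm (continuous_const.mul gradL.continuous.norm)
  intro w hw
  refine closure_minimal ?_ hcl hw
  rintro w ⟨φ, hφ, hw⟩
  rw [mem_ofPred_eq, eq_toH1 hΩ hφ.to_univ hw]
  -- A unit vector exists because d ≥ 1.
  exact norm_fn_toH1_le hΩ.measurableSet hR0.le hR (e := EuclideanSpace.single ⟨0, hd⟩ 1) (by simp) hφ

/-! ### Multiplication by cutoffs. -/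

lemma memLp_mul_fn {χ : E d → ℝ} (h : IsTest univ χ) (y : L2 Ω) :
    MemLp (fun x => χ x * y x) 2 (volume.restrict Ω) :=
  (Lp.memLp y).smul (h.memLp ∞ (volume.restrict Ω))

lemma memLp_mul_grad {χ : E d → ℝ} (h : IsTest univ χ) (y : L2 Ω) (G : L2Vec Ω) :
    MemLp (fun x => χ x • G x + y x • gradient χ x) 2 (volume.restrict Ω) :=
  ((Lp.memLp G).smul (h.memLp ∞ (volume.restrict Ω))).add
    ((h.memLp_gradient ∞ (volume.restrict Ω)).smul (Lp.memLp y))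

/-- By the Leibniz rule the cutoff moves from the function to the test function. Hence cutoffs
preserve both H¹(Ω) and the existence of a zero extension. -/
lemma weakDefect_mul {χ ψ : E d → ℝ} (h : IsTest univ χ) (hψ : IsTest univ ψ) (v : E d)
    (y : L2 Ω) (G : L2Vec Ω) :
    weakDefect ψ v ((memLp_mul_fn h y).toLp _) ((memLp_mul_grad h y G).toLp _) =
      weakDefect (fun x => χ x * ψ x) v y G := by
  have hχψ : IsTest univ (fun x => χ x * ψ x) := hψ.mul_left h.contDiff
  rw [weakDefect, weakDefect, ← integral_add (hψ.integrable_mul_fderiv _ v)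
    (hψ.integrable_inner_mul _ v), ← integral_add (hχψ.integrable_mul_fderiv _ v)
    (hχψ.integrable_inner_mul _ v)]
  refine integral_congr_ae ?_
  filter_upwards [(memLp_mul_fn h y).coeFn_toLp, (memLp_mul_grad h y G).coeFn_toLp] with x h1 h2
  rw [h1, h2, fderiv_mul_apply h.differentiable hψ.differentiable, inner_add_left,
    real_inner_smul_left, real_inner_smul_left, inner_gradient]
  ring

/-- The product of an element of `H¹(Ω)` with a smooth compactly supported function. -/
def IsTest.mulH1 {χ : E d → ℝ} (h : IsTest univ χ) (y : H1 Ω) : H1 Ω :=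
  ⟨WithLp.toLp 2 ((memLp_mul_fn h (fn y)).toLp _, (memLp_mul_grad h (fn y) (grad y)).toLp _),
    isWeakGradient_iff.2 fun _ hφ v => (weakDefect_mul h hφ.to_univ v (fn y) (grad y)).trans
      (isWeakGradient_iff.1 y.2 _ (hφ.mul_left h.contDiff) v)⟩

lemma IsTest.fn_mulH1 {χ : E d → ℝ} (h : IsTest univ χ) (y : H1 Ω) :
    fn (h.mulH1 y) =ᵐ[volume.restrict Ω] fun x => χ x * fn y x :=
  (memLp_mul_fn h (fn y)).coeFn_toLp

lemma IsTest.weakDefect_mulH1 {χ ψ : E d → ℝ} (h : IsTest univ χ) (hψ : IsTest univ ψ) (v : E d)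
    (y : H1 Ω) : weakDefect ψ v (fn (h.mulH1 y)) (grad (h.mulH1 y)) =
      weakDefect (fun x => χ x * ψ x) v (fn y) (grad y) :=
  weakDefect_mul h hψ v (fn y) (grad y)

/-! ### Elementary properties of traces. -/

/-- The difference of two functions with the same trace is a limit of smooth functions whose
boundary values tend to zero. -/
lemma HasTrace.exists_tendsto_sub (hΩ : IsOpen Ω) {y z : H1 Ω} {g : L2Bdry Ω}
    (hy : HasTrace y g) (hz : HasTrace z g) :
    ∃ (φ : ℕ → E d → ℝ) (hφ : ∀ n, IsTest univ (φ n)),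
      Tendsto (fun n => (hφ n).toH1 Ω) atTop (𝓝 (y - z)) ∧
        Tendsto (fun n => eLpNorm (φ n) 2 (surface Ω)) atTop (𝓝 0) := by
  obtain ⟨φ, w, hφ, hw, hwy, hφg⟩ := hy
  obtain ⟨ψ, t, hψ, ht, htz, hψg⟩ := hz
  have hφ' : ∀ n, IsTest univ (φ n) := fun n => ⟨(hφ n).1, (hφ n).2, subset_univ _⟩
  have hψ' : ∀ n, IsTest univ (ψ n) := fun n => ⟨(hψ n).1, (hψ n).2, subset_univ _⟩
  have hsub : ∀ n, IsTest univ (fun x => φ n x + -ψ n x) := fun n => (hφ' n).add (hψ' n).neg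
  refine ⟨_, hsub, ?_, ?_⟩
  · refine (hwy.sub htz).congr fun n => eq_toH1 hΩ (hsub n) ?_
    filter_upwards [Lp.coeFn_sub (fn (w n)) (fn (t n)), hw n, ht n] with x h1 h2 h3
    rw [fn_sub, h1, Pi.sub_apply, h2, h3, sub_eq_add_neg]
  · refine tendsto_of_tendsto_of_tendsto_of_le_of_le tendsto_const_nhds
      (by simpa using hφg.add hψg) (fun _ => zero_le) fun n => ?_
    have e : (fun x => φ n x + -ψ n x) =
        (fun x => φ n x - g x) - fun x => ψ n x - g x := by
      funext x; simp only [Pi.sub_apply]; ring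
    rw [e]
    refine eLpNorm_sub_le ?_ ?_ (by norm_num)
    · exact (hφ' n).continuous.aestronglyMeasurable.sub (Lp.aestronglyMeasurable g)
    · exact (hψ' n).continuous.aestronglyMeasurable.sub (Lp.aestronglyMeasurable g)

/-- Adding an element of `H¹₀(Ω)` does not change the trace. -/
lemma HasTrace.add_mem_H10 (hΩ : IsOpen Ω) {y w : H1 Ω} {g : L2Bdry Ω}
    (hy : HasTrace y g) (hw : w ∈ H10 Ω) : HasTrace (y + w) g := by
  obtain ⟨φ, s, hφ, hs, hsy, hφg⟩ := hy
  obtain ⟨t, ht, htw⟩ := mem_closure_iff_seq_limit.1 hw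
  choose ψ hψ htψ using ht
  refine ⟨fun n x => φ n x + ψ n x, fun n => s n + t n, fun n => ?_, fun n => ?_,
    hsy.add htw, hφg.congr fun n => ?_⟩
  · exact ⟨(hφ n).1.add (hψ n).contDiff, (hφ n).2.add (hψ n).hasCompactSupport⟩
  · filter_upwards [Lp.coeFn_add (fn (s n)) (fn (t n)), hs n, htψ n] with x h1 h2 h3
    rw [fn_add, h1, Pi.add_apply, h2, h3]
  · refine eLpNorm_congr_ae ?_
    filter_upwards [ae_restrict_mem isClosed_frontier.measurableSet] with x hx
    rw [(hψ n).eq_zero_of_notMem fun h => (hΩ.frontier_eq ▸ hx).2 h, add_zero]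

/-! ### The coefficient as an operator on vector fields. -/

/-- Multiplication of vector fields by a bounded function. -/
def mulL (u : LInf Ω) : L2Vec Ω →L[ℝ] L2Vec Ω :=
  (ContinuousLinearMap.lsmul ℝ ℝ : ℝ →L[ℝ] E d →L[ℝ] E d).holderL (volume.restrict Ω) ∞ 2 2 u

lemma mulL_apply_ae (u : LInf Ω) (X : L2Vec Ω) :
    mulL u X =ᵐ[volume.restrict Ω] fun x => u x • X x :=
  ContinuousLinearMap.coeFn_holder (r := 2) (ContinuousLinearMap.lsmul ℝ ℝ) u X

/-- This puts the weak equation in operator form. What follows uses only that the operator is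
symmetric, lies between m and M, and depends on u in a Lipschitz way. -/
lemma inner_mulL (u : LInf Ω) (X Y : L2Vec Ω) :
    inner ℝ (mulL u X) Y = ∫ x in Ω, u x * inner ℝ (X x) (Y x) := by
  rw [L2.inner_def]
  refine integral_congr_ae ?_
  filter_upwards [mulL_apply_ae u X] with x hx
  rw [hx, real_inner_smul_left]

lemma inner_mulL_comm (u : LInf Ω) (X Y : L2Vec Ω) :
    inner ℝ (mulL u X) Y = inner ℝ (mulL u Y) X := by
  simp_rw [inner_mulL, real_inner_comm]

lemma mulL_sub (u₁ u₂ : LInf Ω) : mulL (u₁ - u₂) = mulL u₁ - mulL u₂ := map_sub _ _ _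

lemma norm_mulL_le (u : LInf Ω) (X : L2Vec Ω) : ‖mulL u X‖ ≤ ‖u‖ * ‖X‖ := by
  refine (ContinuousLinearMap.norm_holder_apply_apply_le (r := 2)
    (ContinuousLinearMap.lsmul ℝ ℝ : ℝ →L[ℝ] E d →L[ℝ] E d) u X).trans ?_
  have := ContinuousLinearMap.opNorm_lsmul_le (𝕜 := ℝ) (R := ℝ) (E := E d)
  rw [mul_assoc]
  exact mul_le_of_le_one_left (by positivity) this

lemma integrable_mul_inner (u : LInf Ω) (X Y : L2Vec Ω) :
    Integrable (fun x => u x * inner ℝ (X x) (Y x)) (volume.restrict Ω) := by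
  refine (L2.integrable_inner (𝕜 := ℝ) (mulL u X) Y).congr ?_
  filter_upwards [mulL_apply_ae u X] with x hx
  rw [hx, real_inner_smul_left]

lemma integrable_inner_self (X : L2Vec Ω) (c : ℝ) :
    Integrable (fun x => c * inner ℝ (X x) (X x)) (volume.restrict Ω) :=
  (L2.integrable_inner (𝕜 := ℝ) X X).const_mul c

lemma const_mul_norm_sq (X : L2Vec Ω) (c : ℝ) :
    c * ‖X‖ ^ 2 = ∫ x in Ω, c * inner ℝ (X x) (X x) := by
  rw [integral_const_mul, ← L2.inner_def, real_inner_self_eq_norm_sq]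

lemma le_inner_mulL {u : LInf Ω} {m : ℝ} (hu : ∀ᵐ x ∂(volume.restrict Ω), m ≤ u x)
    (X : L2Vec Ω) : m * ‖X‖ ^ 2 ≤ inner ℝ (mulL u X) X := by
  rw [inner_mulL, const_mul_norm_sq]
  refine integral_mono_ae (integrable_inner_self X m) (integrable_mul_inner u X X) ?_
  filter_upwards [hu] with x hx
  exact mul_le_mul_of_nonneg_right hx real_inner_self_nonneg

lemma inner_mulL_le {u : LInf Ω} {M : ℝ} (hu : ∀ᵐ x ∂(volume.restrict Ω), u x ≤ M)
    (X : L2Vec Ω) : inner ℝ (mulL u X) X ≤ M * ‖X‖ ^ 2 := by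
  rw [inner_mulL, const_mul_norm_sq]
  refine integral_mono_ae (integrable_mul_inner u X X) (integrable_inner_self X M) ?_
  filter_upwards [hu] with x hx
  exact mul_le_mul_of_nonneg_right hx real_inner_self_nonneg

/-! ### The abstract elliptic problem in Hilbert space. -/

section Abstract

variable {W X : Type*} [NormedAddCommGroup W] [InnerProductSpace ℝ W]
  [NormedAddCommGroup X] [InnerProductSpace ℝ X] {V : Submodule ℝ W} {D : W →L[ℝ] X} {K : ℝ}

/-- Lax–Milgram for the form `(φ, ψ) ↦ ⟪A (D φ), D ψ⟫`. -/
lemma exists_inner_eq_of_coercive [CompleteSpace V] (hK : 0 < K) (hV : ∀ w ∈ V, ‖w‖ ≤ K * ‖D w‖)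
    {A : X →L[ℝ] X} {m : ℝ} (hm : 0 < m) (hA : ∀ x, m * ‖x‖ ^ 2 ≤ inner ℝ (A x) x)
    (L : StrongDual ℝ V) : ∃ w : V, ∀ φ : V, inner ℝ (A (D w)) (D φ) = L φ := by
  let B : V →L[ℝ] V →L[ℝ] ℝ :=
    (innerSL ℝ).bilinearComp (A ∘L D ∘L V.subtypeL) (D ∘L V.subtypeL)
  have hB : ∀ φ ψ : V, B φ ψ = inner ℝ (A (D φ)) (D ψ) := fun _ _ => rfl
  have hc : IsCoercive B := by
    -- The form is bounded below by m‖Dw‖², and ‖Dw‖ ≥ ‖w‖ / K.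
    refine ⟨m / K ^ 2, by positivity, fun w => ?_⟩
    have h2 : ‖w‖ ^ 2 ≤ (K * ‖D w‖) ^ 2 := pow_le_pow_left₀ (norm_nonneg _) (hV w w.2) 2
    rw [mul_pow, mul_comm] at h2
    rw [hB]
    refine le_trans ?_ (hA _)
    rw [mul_assoc, ← sq, div_mul_eq_mul_div, div_le_iff₀ (by positivity), mul_assoc]
    gcongr
  refine ⟨hc.continuousLinearEquivOfBilin.symm ((InnerProductSpace.toDual ℝ _).symm L),
    fun φ => ?_⟩
  rw [← hB, ← hc.continuousLinearEquivOfBilin_apply, ContinuousLinearEquiv.apply_symm_apply,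
    InnerProductSpace.toDual_symm_apply]

/-- The infimum defining the dual norm is itself an admissible constant. The set is nonempty since
‖f‖K belongs to it, and where Dφ = 0 the same bound forces f φ = 0. -/
lemma abs_le_sInf_mul (hV : ∀ w ∈ V, ‖w‖ ≤ K * ‖D w‖) (hK : 0 < K) (f : StrongDual ℝ V) (φ : V) :
    |f φ| ≤ sInf {C : ℝ | 0 ≤ C ∧ ∀ φ : V, |f φ| ≤ C * ‖D φ‖} * ‖D φ‖ := by
  have hbd : ∀ φ : V, |f φ| ≤ ‖f‖ * K * ‖D φ‖ := fun φ => by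
    rw [mul_assoc]
    exact (f.le_opNorm φ).trans (mul_le_mul_of_nonneg_left (hV φ φ.2) (norm_nonneg f))
  rcases (norm_nonneg (D φ)).eq_or_lt with h0 | h0
  · have := hbd φ
    rwa [← h0, mul_zero] at this ⊢
  · rw [← div_le_iff₀ h0]
    refine le_csInf ⟨‖f‖ * K, by positivity, hbd⟩ ?_
    rintro C ⟨-, hC⟩
    rw [div_le_iff₀ h0]
    exact hC φ

/-- The energy bound for a solution in terms of an arbitrary extension of the boundary data. -/
lemma norm_solution_le [CompleteSpace V] (hK : 0 < K) (hV : ∀ w ∈ V, ‖w‖ ≤ K * ‖D w‖)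
    {A : X →L[ℝ] X} {m M : ℝ} (hm : 0 < m) (hmM : m ≤ M)
    (hA : ∀ x, m * ‖x‖ ^ 2 ≤ inner ℝ (A x) x) (hA' : ∀ x, inner ℝ (A x) x ≤ M * ‖x‖ ^ 2)
    (hsymm : ∀ x x', inner ℝ (A x) x' = inner ℝ (A x') x)
    {f : StrongDual ℝ V} {N : ℝ} (hN : 0 ≤ N) (hf : ∀ φ : V, |f φ| ≤ N * ‖D φ‖) {y z : W}
    (hy : ∀ φ : V, inner ℝ (A (D y)) (D φ) = f φ) (hyz : y - z ∈ V) :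
    m * ‖D y‖ ≤ N + M * ‖D z‖ := by
  -- Splitting off the part w ∈ V that carries f, instead of estimating y - z directly, gives the
  -- factor M in front of ‖D z‖ rather than m + M.
  obtain ⟨w, hw⟩ := exists_inner_eq_of_coercive hK hV hm hA f
  have hwn : m * ‖D w‖ ≤ N := by
    have h1 := hA (D w)
    rw [hw] at h1
    have h2 := (le_abs_self _).trans (hf w)
    rcases (norm_nonneg (D w)).eq_or_lt with h0 | h0
    · rwa [← h0, mul_zero]
    · refine le_of_mul_le_mul_right ?_ h0
      linarith
  obtain ⟨h, hh⟩ : ∃ h : W, h = y - w := ⟨_, rfl⟩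
  have horth : ∀ φ ∈ V, inner ℝ (A (D h)) (D φ) = 0 := fun φ hφ => by
    rw [hh, map_sub, map_sub, inner_sub_left, hy ⟨φ, hφ⟩, ← hw ⟨φ, hφ⟩, sub_self]
  have hhz : h - z ∈ V := by
    have : h - z = (y - z) - w := by rw [hh]; abel
    rw [this]
    exact V.sub_mem hyz w.2
  have hM : 0 < M := hm.trans_le hmM
  -- Dirichlet's principle: h is orthogonal in energy to h - z, so its energy is at most that of z.
  -- This gives m‖Dh‖² ≤ M‖Dz‖², and m ≤ M turns it into the stated linear bound.
  have hhn : m * ‖D h‖ ≤ M * ‖D z‖ := by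
    have e1 := horth _ hhz
    rw [map_sub, inner_sub_right, sub_eq_zero] at e1
    have e2 : 0 ≤ inner ℝ (A (D h - D z)) (D h - D z) :=
      le_trans (by positivity) (hA _)
    rw [map_sub, inner_sub_left, inner_sub_right, inner_sub_right, hsymm (D z) (D h)] at e2
    have e3 := hA (D h)
    have e4 := hA' (D z)
    have e5 : m * ‖D h‖ ^ 2 ≤ M * ‖D z‖ ^ 2 := by linarith
    refine abs_le_of_sq_le_sq' ?_ (by positivity) |>.2
    calc (m * ‖D h‖) ^ 2 = m * (m * ‖D h‖ ^ 2) := by ring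
      _ ≤ m * (M * ‖D z‖ ^ 2) := by gcongr
      _ ≤ M * (M * ‖D z‖ ^ 2) := by gcongr
      _ = (M * ‖D z‖) ^ 2 := by ring
  have hyh : D y = D w + D h := by
    rw [hh, map_sub]; abel
  calc m * ‖D y‖ ≤ m * (‖D w‖ + ‖D h‖) := by
        rw [hyh]; gcongr; exact norm_add_le _ _
    _ ≤ N + M * ‖D z‖ := by rw [mul_add]; gcongr

/-- Dependence of the solution on the coefficient. -/
lemma norm_sub_solution_le {A₁ A₂ : X →L[ℝ] X} {m : ℝ} (hA : ∀ x, m * ‖x‖ ^ 2 ≤ inner ℝ (A₁ x) x)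
    {f : StrongDual ℝ V} {y₁ y₂ : W} (h₁ : ∀ φ : V, inner ℝ (A₁ (D y₁)) (D φ) = f φ)
    (h₂ : ∀ φ : V, inner ℝ (A₂ (D y₂)) (D φ) = f φ) (hmem : y₁ - y₂ ∈ V) :
    m * ‖D (y₁ - y₂)‖ ≤ ‖(A₁ - A₂) (D y₂)‖ := by
  set δ : W := y₁ - y₂
  -- The difference of the two equations, tested with δ itself.
  have key : inner ℝ (A₁ (D δ)) (D δ) = -inner ℝ ((A₁ - A₂) (D y₂)) (D δ) := by
    have e1 := h₁ ⟨δ, hmem⟩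
    have e2 := h₂ ⟨δ, hmem⟩
    have e3 : D δ = D y₁ - D y₂ := map_sub _ _ _
    have e4 : A₁ (D δ) = A₁ (D y₁) - A₁ (D y₂) := by rw [e3, map_sub]
    dsimp only at e1 e2
    rw [e4, sub_apply, inner_sub_left, inner_sub_left, e2, ← e1]
    ring
  have h4 : m * ‖D δ‖ ^ 2 ≤ ‖(A₁ - A₂) (D y₂)‖ * ‖D δ‖ := by
    refine (hA _).trans ?_
    rw [key]
    exact (neg_le_abs _).trans (abs_real_inner_le_norm _ _)
  rcases (norm_nonneg (D δ)).eq_or_lt with h0 | h0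
  · rw [← h0, mul_zero]; positivity
  · refine le_of_mul_le_mul_right ?_ h0
    linarith

/-- Well-posedness and Lipschitz dependence on the coefficient, in abstract form: `T` is the set of
functions with the prescribed boundary values. -/
lemma exists_lipschitz_solution_map [CompleteSpace V] (hK : 0 < K)
    (hV : ∀ w ∈ V, ‖w‖ ≤ K * ‖D w‖) (hD : ∀ w, ‖D w‖ ≤ ‖w‖) {P : Type*} [PseudoMetricSpace P]
    {A : P → X →L[ℝ] X} {m M : ℝ} (hm : 0 < m) (hmM : m ≤ M)
    (hA : ∀ p x, m * ‖x‖ ^ 2 ≤ inner ℝ (A p x) x) (hA' : ∀ p x, inner ℝ (A p x) x ≤ M * ‖x‖ ^ 2)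
    (hsymm : ∀ p x x', inner ℝ (A p x) x' = inner ℝ (A p x') x)
    (hdist : ∀ p q x, ‖(A p - A q) x‖ ≤ dist p q * ‖x‖) {T : Set W}
    (hT : ∀ {y z}, y ∈ T → z ∈ T → y - z ∈ V) (hT' : ∀ {y w}, y ∈ T → w ∈ V → y + w ∈ T)
    (hne : T.Nonempty) (f : StrongDual ℝ V) :
    ∃ S : P → W,
      (∀ p y, ((∀ φ : V, inner ℝ (A p (D y)) (D φ) = f φ) ∧ y ∈ T) ↔ y = S p) ∧
      (∀ p q, S p - S q ∈ V ∧ ‖D (S p - S q)‖ ≤ 1 / m ^ 2 * dist p q *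
        (sInf {C : ℝ | 0 ≤ C ∧ ∀ φ : V, |f φ| ≤ C * ‖D φ‖} +
          M * sInf {r : ℝ | ∃ y, y ∈ T ∧ r = ‖y‖})) ∧
      ∃ K : ℝ≥0, LipschitzWith K S := by
  have hM : 0 < M := hm.trans_le hmM
  obtain ⟨z, hz⟩ := hne
  obtain ⟨N, hNdef⟩ : ∃ N, N = sInf {C : ℝ | 0 ≤ C ∧ ∀ φ : V, |f φ| ≤ C * ‖D φ‖} := ⟨_, rfl⟩
  obtain ⟨G, hGdef⟩ : ∃ G, G = sInf {r : ℝ | ∃ y, y ∈ T ∧ r = ‖y‖} := ⟨_, rfl⟩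
  have hN0 : 0 ≤ N := hNdef ▸ Real.sInf_nonneg fun _ h => h.1
  have hG0 : 0 ≤ G := hGdef ▸ Real.sInf_nonneg fun _ ⟨y, _, h⟩ => h ▸ norm_nonneg y
  have hf : ∀ φ : V, |f φ| ≤ N * ‖D φ‖ := hNdef ▸ abs_le_sInf_mul hV hK f
  rw [← hNdef, ← hGdef]
  have hex : ∀ p, ∃ y, (∀ φ : V, inner ℝ (A p (D y)) (D φ) = f φ) ∧ y ∈ T := fun p => by
    -- Lifting: with z ∈ T fixed, the correction w ∈ V solves the problem with right-hand side f -
    -- L.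
    let L : StrongDual ℝ V := (innerSL ℝ (A p (D z))) ∘L D ∘L V.subtypeL
    obtain ⟨w, hw⟩ := exists_inner_eq_of_coercive hK hV hm (hA p) (f - L)
    refine ⟨z + w, fun φ => ?_, hT' hz w.2⟩
    have h1 : inner ℝ (A p (D w)) (D φ) = f φ - inner ℝ (A p (D z)) (D φ) := hw φ
    rw [map_add, map_add, inner_add_left, h1]
    ring
  choose S hS hST using hex
  have hdiff : ∀ p q y₁ y₂, (∀ φ : V, inner ℝ (A p (D y₁)) (D φ) = f φ) → y₁ ∈ T →
      (∀ φ : V, inner ℝ (A q (D y₂)) (D φ) = f φ) → y₂ ∈ T →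
      ‖D (y₁ - y₂)‖ ≤ 1 / m ^ 2 * dist p q * (N + M * G) := by
    intro p q y₁ y₂ h₁ t₁ h₂ t₂
    have hy₂ : m * ‖D y₂‖ ≤ N + M * G := by
      -- The energy bound holds for every extension t ∈ T; in this form it is a lower bound for the
      -- set whose infimum is G.
      suffices (m * ‖D y₂‖ - N) / M ≤ G by
        rw [div_le_iff₀ hM] at this
        linarith
      rw [hGdef]
      refine le_csInf ⟨_, y₂, t₂, rfl⟩ ?_
      rintro _ ⟨t, ht, rfl⟩
      rw [div_le_iff₀ hM]
      have h3 := norm_solution_le hK hV hm hmM (hA q) (hA' q) (hsymm q) hN0 hf h₂ (hT t₂ ht)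
      have h4 : M * ‖D t‖ ≤ M * ‖t‖ := mul_le_mul_of_nonneg_left (hD t) hM.le
      linarith
    have h5 := (norm_sub_solution_le (hA p) h₁ h₂ (hT t₁ t₂)).trans (hdist p q _)
    rw [one_div, mul_assoc, inv_mul_eq_div, le_div_iff₀ (by positivity)]
    calc ‖D (y₁ - y₂)‖ * m ^ 2 = m * (m * ‖D (y₁ - y₂)‖) := by ring
      _ ≤ m * (dist p q * ‖D y₂‖) := by gcongr
      _ = dist p q * (m * ‖D y₂‖) := by ring
      _ ≤ _ := by gcongr
  have hSd := fun p q => hdiff p q _ _ (hS p) (hST p) (hS q) (hST q)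
  refine ⟨S, fun p y => ⟨fun hy => ?_, fun hy => hy ▸ ⟨hS p, hST p⟩⟩,
    fun p q => ⟨hT (hST p) (hST q), hSd p q⟩, ?_⟩
  -- Uniqueness is the estimate for equal coefficients.
  · have h2 := hdiff p p y (S p) hy.1 hy.2 (hS p) (hST p)
    have h3 := hV _ (hT hy.2 (hST p))
    rw [dist_self, mul_zero, zero_mul] at h2
    refine sub_eq_zero.1 (norm_le_zero_iff.1 (h3.trans ?_))
    exact mul_nonpos_of_nonneg_of_nonpos hK.le h2
  · refine ⟨NNReal.mk (K * (1 / m ^ 2 * (N + M * G))) (by positivity),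
      LipschitzWith.of_dist_le_mul fun p q => ?_⟩
    rw [dist_eq_norm]
    refine (hV _ (hT (hST p) (hST q))).trans
      ((mul_le_mul_of_nonneg_left (hSd p q) hK.le).trans_eq ?_)
    rw [NNReal.coe_mk]
    ring

end Abstract

/-! ### The conductivity equation as an instance of the abstract problem. -/

lemma norm_le_of_poincare {C : ℝ} {w : H1 Ω} (h : ‖fn w‖ ≤ C * ‖grad w‖) :
    ‖w‖ ≤ √(1 + C ^ 2) * ‖gradL w‖ := by
  refine abs_le_of_sq_le_sq' ?_ (by positivity) |>.2
  rw [norm_sq_eq, mul_pow, Real.sq_sqrt (by positivity), gradL_apply]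
  have := pow_le_pow_left₀ (norm_nonneg _) h 2
  nlinarith

lemma isSolution_iff {u : LInf Ω} {f : HNeg1 Ω} {g : L2Bdry Ω} {y : H1 Ω} :
    IsSolution u f g y ↔
      (∀ φ : H10 Ω, inner ℝ (mulL u (gradL y)) (gradL (φ : H1 Ω)) = f φ) ∧ HasTrace y g := by
  simp only [IsSolution, inner_mulL, gradL_apply]

set_option maxHeartbeats 1000000 in
/-- The theorem, given that functions with the same trace differ by an element of `H¹₀(Ω)`. -/
lemma exists_solution_map (hd : 1 ≤ d) (hΩ : IsOpen Ω) (hb : Bornology.IsBounded Ω)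
    (hker : ∀ {y z : H1 Ω} {g : L2Bdry Ω}, HasTrace y g → HasTrace z g → y - z ∈ H10 Ω)
    (F : Submodule ℝ (LInf Ω)) {m M : ℝ} (hm : 0 < m) (hmM : m ≤ M)
    (f : HNeg1 Ω) (g : L2Bdry Ω) (hg : MemH12 g) :
    ∃ S : U F m M → H1 Ω,
      (∀ (u : U F m M) (y : H1 Ω), IsSolution (u : LInf Ω) f g y ↔ y = S u) ∧
      (∀ u₁ u₂ : U F m M, S u₁ - S u₂ ∈ H10 Ω ∧
        h10Norm (S u₁ - S u₂) ≤
          1 / m ^ 2 * ‖(u₁ : LInf Ω) - (u₂ : LInf Ω)‖ * (hNeg1Norm f + M * h12Norm g)) ∧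
      ∃ K : ℝ≥0, LipschitzWith K S := by
  obtain ⟨C, hC0, hC⟩ := exists_norm_fn_le hd hΩ hb
  obtain ⟨S, h₁, h₂, h₃⟩ := exists_lipschitz_solution_map (W := H1 Ω) (X := L2Vec Ω) (V := H10 Ω)
    (D := gradL) (K := √(1 + C ^ 2)) (by positivity) (fun w hw => norm_le_of_poincare (hC w hw))
    norm_grad_le (P := U F m M) (A := fun u => mulL (u : LInf Ω)) hm hmM
    (fun u => le_inner_mulL (u.2.2.mono fun _ h => h.1))
    (fun u => inner_mulL_le (u.2.2.mono fun _ h => h.2)) (fun u => inner_mulL_comm (u : LInf Ω))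
    (fun u₁ u₂ X => by
      have h := norm_mulL_le ((u₁ : LInf Ω) - (u₂ : LInf Ω)) X
      rwa [mulL_sub, ← dist_eq_norm] at h)
    (T := {y | HasTrace y g}) hker (fun hy hw => HasTrace.add_mem_H10 hΩ hy hw) hg f
  refine ⟨S, fun u y => isSolution_iff.trans (h₁ u y), fun u₁ u₂ => ⟨(h₂ u₁ u₂).1, ?_⟩, h₃⟩
  rw [← dist_eq_norm]
  exact (h₂ u₁ u₂).2

/-! ### Mollification in L². -/

section Mollification

variable {F : Type*} [NormedAddCommGroup F]

/-- Translations act continuously on `L²`. -/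
lemma exists_eLpNorm_translate_sub_le {f : E d → F} (hf : MemLp f 2 volume) {ε : ℝ≥0∞}
    (hε : ε ≠ 0) :
    ∃ δ > 0, ∀ s : E d, ‖s‖ < δ → eLpNorm (fun x => f (x - s) - f x) 2 volume ≤ ε := by
  let g : C(E d, C(E d, E d)) := (ContinuousMap.mk (fun p : E d × E d => p.2 - p.1)).curry
  have hg : ∀ s, MeasurePreserving (g s) volume volume := fun s =>
    measurePreserving_sub_right volume s
  have ht := (tendsto_const_nhds (x := hf.toLp f)).compMeasurePreservingLp
    (g.continuous.tendsto (0 : E d)) hg (hg 0) (by norm_num : (2 : ℝ≥0∞) ≠ ⊤)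
  have h0 : Lp.compMeasurePreserving (g 0) (hg 0) (hf.toLp f) = hf.toLp f := by
    rw [Lp.toLp_compMeasurePreserving]
    refine MemLp.toLp_congr _ _ (ae_of_all _ fun x => ?_)
    change f (x - 0) = f x
    rw [sub_zero]
  rw [h0] at ht
  have hev := ht.eventually (Metric.eball_mem_nhds _ (pos_iff_ne_zero.2 hε))
  obtain ⟨δ, hδ, hball⟩ := Metric.eventually_nhds_iff.1 hev
  refine ⟨δ, hδ, fun s hs => ?_⟩
  have := hball (by simpa using hs)
  rw [Lp.toLp_compMeasurePreserving, Lp.edist_toLp_toLp] at this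
  exact this.le

variable [NormedSpace ℝ F] [CompleteSpace F]

/-- Mollification moves an `L²` function at most as far as the translations it averages. -/
lemma eLpNorm_mollify_sub_le {f : E d → F} (hf : MemLp f 2 volume) (hfm : StronglyMeasurable f)
    {η : E d → ℝ} (hη : Continuous η) (hηc : HasCompactSupport η) (hη0 : ∀ x, 0 ≤ η x)
    (hη1 : ∫ x, η x = 1) {ε : ℝ≥0∞}
    (hε : ∀ s, η s ≠ 0 → eLpNorm (fun x => f (x - s) - f x) 2 volume ≤ ε) :
    eLpNorm (fun x => (∫ z, η (x - z) • f z) - f x) 2 volume ≤ ε := by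
  have hηi : Integrable η := hη.integrable_of_hasCompactSupport hηc
  have hηm : Measurable fun s => (η s).toNNReal := hη.measurable.real_toNNReal
  -- Against this probability measure the mollification error is the mean of f(x - s) - f(x).
  -- Jensen's inequality and Tonelli's theorem then bound its L² norm by that of the single
  -- translations.
  let ν : Measure (E d) := volume.withDensity fun s => ((η s).toNNReal : ℝ≥0∞)
  have hν : IsProbabilityMeasure ν := ⟨by
    rw [withDensity_apply _ MeasurableSet.univ, setLIntegral_univ]
    change ∫⁻ x, ENNReal.ofReal (η x) = 1
    rw [← ofReal_integral_eq_lintegral_ofReal hηi (ae_of_all _ hη0), hη1, ENNReal.ofReal_one]⟩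
  have hνae : ∀ᵐ s ∂ν, η s ≠ 0 := by
    refine (ae_withDensity_iff hηm.coe_nnreal_ennreal).2 (ae_of_all _ fun s hs h => hs ?_)
    simp [h]
  have hloc : LocallyIntegrable f volume := hf.locallyIntegrable (by norm_num)
  have hint : ∀ x, Integrable (fun s => f (x - s)) ν := fun x => by
    rw [integrable_withDensity_iff_integrable_smul hηm]
    have h1 : Integrable (fun z => η (x - z) • f z) volume :=
      hηc.convolutionExists_right (ContinuousLinearMap.lsmul ℝ ℝ).flip hloc hη x
    refine (h1.comp_sub_left x).congr (ae_of_all _ fun s => ?_)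
    simp only [sub_sub_cancel, NNReal.smul_def, Real.coe_toNNReal _ (hη0 s)]
  have hmol : ∀ x, (∫ z, η (x - z) • f z) - f x = ∫ s, (f (x - s) - f x) ∂ν := fun x => by
    rw [integral_sub (hint x) (integrable_const _), integral_const, probReal_univ, one_smul,
      integral_withDensity_eq_integral_smul hηm,
      ← integral_sub_left_eq_self (fun z => η (x - z) • f z) volume x]
    congr 1
    refine integral_congr_ae (ae_of_all _ fun s => ?_)
    simp only [sub_sub_cancel, NNReal.smul_def, Real.coe_toNNReal _ (hη0 s)]
  have hmeas : StronglyMeasurable fun p : E d × E d => f (p.1 - p.2) - f p.1 :=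
    (hfm.comp_measurable (measurable_fst.sub measurable_snd)).sub
      (hfm.comp_measurable measurable_fst)
  have hjensen : ∀ x, ‖(∫ z, η (x - z) • f z) - f x‖ₑ ^ (2 : ℝ) ≤
      ∫⁻ s, ‖f (x - s) - f x‖ₑ ^ (2 : ℝ) ∂ν := fun x => by
    rw [hmol x]
    have h1 := eLpNorm_le_eLpNorm_of_exponent_le (p := 1) (q := 2) (μ := ν) (by norm_num)
      (f := fun s => f (x - s) - f x)
      (hmeas.comp_measurable (measurable_const.prodMk measurable_id)).aestronglyMeasurable
    rw [eLpNorm_one_eq_lintegral_enorm] at h1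
    have h2 := eLpNorm_nnreal_pow_eq_lintegral (μ := ν) (f := fun s => f (x - s) - f x)
      (p := 2) (by norm_num)
    calc _ ≤ (∫⁻ s, ‖f (x - s) - f x‖ₑ ∂ν) ^ (2 : ℝ) := by
            gcongr; exact enorm_integral_le_lintegral_enorm _
      _ ≤ (eLpNorm (fun s => f (x - s) - f x) 2 ν) ^ (2 : ℝ) := by gcongr
      _ = _ := by simpa using h2
  have hsq : ∀ g : E d → F, eLpNorm g 2 volume ^ (2 : ℝ) = ∫⁻ x, ‖g x‖ₑ ^ (2 : ℝ) := fun g => by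
    simpa using eLpNorm_nnreal_pow_eq_lintegral (μ := volume) (f := g) (p := 2) (by norm_num)
  rw [← ENNReal.rpow_le_rpow_iff (z := 2) (by norm_num), hsq]
  calc ∫⁻ x, ‖(∫ z, η (x - z) • f z) - f x‖ₑ ^ (2 : ℝ)
      ≤ ∫⁻ x, ∫⁻ s, ‖f (x - s) - f x‖ₑ ^ (2 : ℝ) ∂ν := lintegral_mono hjensen
    _ = ∫⁻ s, (∫⁻ x, ‖f (x - s) - f x‖ₑ ^ (2 : ℝ)) ∂ν :=
        lintegral_lintegral_swap (hmeas.enorm.pow_const 2).aemeasurable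
    _ ≤ ∫⁻ _, ε ^ (2 : ℝ) ∂ν := by
        refine lintegral_mono_ae ?_
        filter_upwards [hνae] with s hs
        rw [← hsq (fun x => f (x - s) - f x)]
        gcongr
        exact hε s hs
    _ = ε ^ (2 : ℝ) := by rw [lintegral_const, measure_univ, mul_one]

end Mollification

/-! ### Zero extensions and approximation by test functions. -/

/-- An element of `H¹(Ω)` whose extension by zero has the extension by zero of its gradient as weak
gradient on the whole space. -/
def HasZeroExtension (y : H1 Ω) : Prop :=
  ∀ ψ : E d → ℝ, IsTest univ ψ → ∀ v, weakDefect ψ v (fn y) (grad y) = 0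

lemma HasZeroExtension.mulH1 {y : H1 Ω} (hy : HasZeroExtension y) {χ : E d → ℝ}
    (h : IsTest univ χ) : HasZeroExtension (h.mulH1 y) := fun ψ hψ v => by
  rw [h.weakDefect_mulH1 hψ]
  exact hy _ (hψ.mul_left h.contDiff) v

lemma memLp_indicator {F : Type*} [NormedAddCommGroup F] (hΩ : MeasurableSet Ω)
    (f : Lp F 2 (volume.restrict Ω)) : MemLp (Ω.indicator f) 2 volume :=
  (memLp_indicator_iff_restrict hΩ).2 (Lp.memLp f)

/-- The gradient of a mollification is the mollification of the weak gradient. -/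
lemma HasZeroExtension.gradient_mollify (hΩ : MeasurableSet Ω) {y : H1 Ω}
    (hy : HasZeroExtension y) {η : E d → ℝ} (hη : IsTest univ η) (x : E d) :
    gradient (fun x => ∫ z, η (x - z) • Ω.indicator (fn y) z) x =
      ∫ z, η (x - z) • Ω.indicator (grad y) z := by
  have hloc : LocallyIntegrable (Ω.indicator (fn y)) volume :=
    (memLp_indicator hΩ (fn y)).locallyIntegrable (by norm_num)
  have hlocG : LocallyIntegrable (Ω.indicator (grad y)) volume :=
    (memLp_indicator hΩ (grad y)).locallyIntegrable (by norm_num)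
  refine ext_inner_right ℝ fun v => ?_
  rw [inner_gradient]
  have hder := hη.hasCompactSupport.hasFDerivAt_convolution_right
    (ContinuousLinearMap.lsmul ℝ ℝ).flip hloc (hη.contDiff.of_le (by simp)) x
  have hder' := hder.fderiv
  change fderiv ℝ (fun x => ∫ z, η (x - z) • Ω.indicator (fn y) z) x = _ at hder'
  rw [hder', convolution_precompR_apply _ hloc (hη.hasCompactSupport.fderiv ℝ)
    (hη.contDiff.continuous_fderiv (by simp)), convolution_def]
  -- The support of this kernel may cross ∂Ω, which is why a zero extension is required.
  let ψ : E d → ℝ := fun z => η (x - z)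
  have hψ : IsTest univ ψ :=
    ⟨hη.contDiff.comp (contDiff_const.sub contDiff_id),
      hη.hasCompactSupport.comp_homeomorph (Homeomorph.subLeft x), subset_univ _⟩
  have hψ' : ∀ z, fderiv ℝ ψ z v = -fderiv ℝ η (x - z) v := fun z => by
    have h1 : HasFDerivAt ψ ((fderiv ℝ η (x - z)).comp (-ContinuousLinearMap.id ℝ (E d))) z :=
      (hη.differentiable (x - z)).hasFDerivAt.comp z ((hasFDerivAt_id z).const_sub x)
    rw [h1.fderiv]
    simp
  have hZ := hy ψ hψ v
  have hint : Integrable (fun z => η (x - z) • Ω.indicator (grad y) z) volume :=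
    hη.hasCompactSupport.convolutionExists_right (ContinuousLinearMap.lsmul ℝ ℝ).flip hlocG
      hη.continuous x
  rw [real_inner_comm, ← integral_inner hint]
  have e1 : ∫ z in Ω, fn y z * fderiv ℝ ψ z v =
      -∫ z, Ω.indicator (fn y) z * fderiv ℝ η (x - z) v := by
    rw [← integral_indicator hΩ, ← integral_neg]
    refine integral_congr_ae (ae_of_all _ fun z => ?_)
    by_cases hz : z ∈ Ω <;> simp [hz, hψ']
  have e2 : ∫ z in Ω, inner ℝ (grad y z) v * ψ z =
      ∫ z, inner ℝ v (η (x - z) • Ω.indicator (grad y) z) := by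
    rw [← integral_indicator hΩ]
    refine integral_congr_ae (ae_of_all _ fun z => ?_)
    by_cases hz : z ∈ Ω
    · simp [hz, real_inner_smul_right, real_inner_comm, ψ, mul_comm]
    · simp [hz]
  rw [weakDefect, e1, e2] at hZ
  rw [← sub_eq_zero, ← neg_eq_zero, ← hZ]
  simp only [ContinuousLinearMap.flip_apply, ContinuousLinearMap.lsmul_apply, smul_eq_mul,
    mul_comm]
  ring

lemma norm_toLp_sub_le {F : Type*} [NormedAddCommGroup F] (hΩ : MeasurableSet Ω)
    {f g : Lp F 2 (volume.restrict Ω)} {φ : E d → F} (hg : g =ᵐ[volume.restrict Ω] φ) {ε : ℝ}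
    (hε : 0 ≤ ε)
    (h : eLpNorm (fun x => φ x - Ω.indicator f x) 2 volume ≤ ENNReal.ofReal ε) :
    ‖g - f‖ ≤ ε := by
  rw [Lp.norm_def]
  refine ENNReal.toReal_le_of_le_ofReal hε (le_trans ?_ h)
  refine le_trans (le_of_eq (eLpNorm_congr_ae ?_)) (eLpNorm_mono_measure _ Measure.restrict_le_self)
  filter_upwards [Lp.coeFn_sub g f, hg, ae_restrict_mem hΩ] with x h1 h2 h3
  rw [h1, Pi.sub_apply, h2, indicator_of_mem h3]

set_option maxHeartbeats 1000000 in
/-- If a function with a zero extension is concentrated on a compact set that can be pushed into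
`Ω` along a cone of directions, then it belongs to `H¹₀(Ω)`. -/
lemma HasZeroExtension.mem_H10 (hΩ : IsOpen Ω) {y : H1 Ω} (hy : HasZeroExtension y)
    {K : Set (E d)} (hK : IsCompact K) (hyK : ∀ᵐ x ∂(volume.restrict Ω), x ∉ K → fn y x = 0)
    {w₀ : E d} {δ : ℝ} (hδ : 0 < δ)
    (hpush : ∀ z ∈ K, ∀ t ∈ Ioo 0 δ, ∀ w ∈ Metric.closedBall w₀ δ, z + t • w ∈ Ω) :
    y ∈ H10 Ω := by
  have hΩm := hΩ.measurableSet
  refine Metric.mem_closure_iff.2 fun ε hε => ?_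
  have hε' : ENNReal.ofReal (ε / 3) ≠ 0 := by
    rw [Ne, ENNReal.ofReal_eq_zero, not_le]; positivity
  obtain ⟨δ₁, hδ₁, h₁⟩ := exists_eLpNorm_translate_sub_le (memLp_indicator hΩm (fn y)) hε'
  obtain ⟨δ₂, hδ₂, h₂⟩ := exists_eLpNorm_translate_sub_le (memLp_indicator hΩm (grad y)) hε'
  obtain ⟨t, ht0, htδ, ht₁, ht₂⟩ : ∃ t : ℝ, 0 < t ∧ t < δ ∧ t * (‖w₀‖ + δ) < δ₁ ∧
      t * (‖w₀‖ + δ) < δ₂ := by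
    have hc : Tendsto (fun t : ℝ => t * (‖w₀‖ + δ)) (𝓝[>] 0) (𝓝 0) := by
      have : Tendsto (fun t : ℝ => t * (‖w₀‖ + δ)) (𝓝 0) (𝓝 (0 * (‖w₀‖ + δ))) :=
        tendsto_id.mul_const _
      rw [zero_mul] at this
      exact this.mono_left nhdsWithin_le_nhds
    have hev := ((eventually_mem_nhdsWithin (a := (0 : ℝ)) (s := Ioi 0)).and
      ((Ioo_mem_nhdsGT hδ))).and ((hc.eventually_lt_const hδ₁).and (hc.eventually_lt_const hδ₂))
    obtain ⟨t, ⟨h1, h2⟩, h3, h4⟩ := hev.exists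
    exact ⟨t, h1, h2.2, h3, h4⟩
  -- The kernel is centred at t w₀ and not at 0: its support consists of vectors t w with w within δ
  -- of w₀, so mollifying moves K by vectors that `hpush` sends into Ω.
  let b : ContDiffBump (t • w₀) := ⟨t * δ / 2, t * δ, by positivity, by linarith [mul_pos ht0 hδ]⟩
  let η : E d → ℝ := b.normed volume
  have hη : IsTest univ η := ⟨b.contDiff_normed, b.hasCompactSupport_normed, subset_univ _⟩
  have hηs : ∀ s, η s ≠ 0 → ∃ w ∈ Metric.closedBall w₀ δ, s = t • w := fun s hs => by
    have hs' : s ∈ Metric.ball (t • w₀) (t * δ) := by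
      have : s ∈ Function.support (b.normed volume) := hs
      rwa [b.support_normed_eq] at this
    refine ⟨t⁻¹ • s, ?_, by rw [smul_inv_smul₀ ht0.ne']⟩
    rw [mem_ball_iff_norm] at hs'
    have e : t⁻¹ • s - w₀ = t⁻¹ • (s - t • w₀) := by rw [smul_sub, inv_smul_smul₀ ht0.ne']
    rw [mem_closedBall_iff_norm, e, norm_smul, norm_inv, Real.norm_of_nonneg ht0.le,
      inv_mul_le_iff₀ ht0]
    exact hs'.le
  have hηn : ∀ s, η s ≠ 0 → ‖s‖ ≤ t * (‖w₀‖ + δ) := fun s hs => by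
    obtain ⟨w, hw, rfl⟩ := hηs s hs
    rw [norm_smul, Real.norm_of_nonneg ht0.le]
    gcongr
    rw [mem_closedBall_iff_norm] at hw
    calc ‖w‖ = ‖w₀ + (w - w₀)‖ := by rw [add_sub_cancel]
      _ ≤ ‖w₀‖ + δ := (norm_add_le _ _).trans (by gcongr)
  have a₁ := eLpNorm_mollify_sub_le (memLp_indicator hΩm (fn y))
    ((Lp.stronglyMeasurable _).indicator hΩm) hη.continuous hη.hasCompactSupport
    b.nonneg_normed b.integral_normed fun s hs => h₁ s ((hηn s hs).trans_lt ht₁)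
  have a₂ := eLpNorm_mollify_sub_le (memLp_indicator hΩm (grad y))
    ((Lp.stronglyMeasurable _).indicator hΩm) hη.continuous hη.hasCompactSupport
    b.nonneg_normed b.integral_normed fun s hs => h₂ s ((hηn s hs).trans_lt ht₂)
  let φ : E d → ℝ := fun x => ∫ z, η (x - z) • Ω.indicator (fn y) z
  have hsupp : tsupport φ ⊆ (fun p : E d × E d => p.1 + t • p.2) ''
      (K ×ˢ Metric.closedBall w₀ δ) := by
    refine closure_minimal (fun x hx => ?_) ((hK.prod (isCompact_closedBall w₀ δ)).image
      (by fun_prop)).isClosed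
    by_contra hcon
    refine hx (integral_eq_zero_of_ae ?_)
    filter_upwards [(ae_restrict_iff' hΩm).1 hyK] with z hz
    by_cases hzΩ : z ∈ Ω
    · by_cases hzK : z ∈ K
      · by_cases hη0 : η (x - z) = 0
        · simp [hη0]
        · obtain ⟨w, hw, hxw⟩ := hηs _ hη0
          exact absurd ⟨(z, w), ⟨hzK, hw⟩, by simp only [← hxw, add_sub_cancel]⟩ hcon
      · simp [hzΩ, hz hzΩ hzK]
    · simp [hzΩ]
  have hφ : IsTest Ω φ := by
    refine ⟨?_, ?_, ?_⟩
    · exact hη.hasCompactSupport.contDiff_convolution_right (n := ⊤)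
        (ContinuousLinearMap.lsmul ℝ ℝ).flip
        ((memLp_indicator hΩm (fn y)).locallyIntegrable (by norm_num)) hη.contDiff
    · exact ((hK.prod (isCompact_closedBall w₀ δ)).image (by fun_prop)).of_isClosed_subset
        (isClosed_tsupport _) hsupp
    · refine hsupp.trans ?_
      rintro _ ⟨⟨z, w⟩, ⟨hz, hw⟩, rfl⟩
      exact hpush z hz t ⟨ht0, htδ⟩ w hw
  have hgrad : gradient φ = fun x => ∫ z, η (x - z) • Ω.indicator (grad y) z :=
    funext fun x => hy.gradient_mollify hΩm hη x
  refine ⟨hφ.to_univ.toH1 Ω, hφ.toH1_mem_testH1, ?_⟩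
  have b₁ : ‖fn (hφ.to_univ.toH1 Ω) - fn y‖ ≤ ε / 3 :=
    norm_toLp_sub_le hΩm hφ.to_univ.fn_toH1 (by positivity) a₁
  have b₂ : ‖grad (hφ.to_univ.toH1 Ω) - grad y‖ ≤ ε / 3 :=
    norm_toLp_sub_le hΩm (hφ.to_univ.grad_toH1.trans (hgrad ▸ EventuallyEq.rfl)) (by positivity) a₂
  rw [dist_comm, dist_eq_norm]
  have hsq := norm_sq_eq (hφ.to_univ.toH1 Ω - y)
  rw [fn_sub, grad_sub] at hsq
  refine lt_of_pow_lt_pow_left₀ 2 hε.le ?_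
  rw [hsq]
  have c₁ := pow_le_pow_left₀ (norm_nonneg _) b₁ 2
  have c₂ := pow_le_pow_left₀ (norm_nonneg _) b₂ 2
  nlinarith [sq_pos_of_pos hε]

/-! ### Boundary control of transversal derivatives by slicing. -/

/-- One-dimensional slices: integrating `g'` over `{h < 0}`, with `h` increasing, leaves at most one
boundary value. -/
lemma integral_indicator_deriv {g h : ℝ → ℝ} {J A : Set ℝ} (hg : ContDiff ℝ 1 g)
    (hgc : HasCompactSupport g) (hJ : J.OrdConnected) (hsupp : ∀ t ∉ J, deriv g t = 0)
    (hcont : ContinuousOn h J) (hmono : StrictMonoOn h J) (hA : ∀ t ∈ J, t ∈ A ↔ h t < 0) :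
    (∫ t, A.indicator (deriv g) t = 0) ∨
      ∃ c ∈ J, h c = 0 ∧ ∫ t, A.indicator (deriv g) t = g c := by
  by_cases h1 : ∀ t ∈ J, 0 ≤ h t
  · refine Or.inl (integral_eq_zero_of_ae (ae_of_all _ fun t => ?_))
    by_cases ht : t ∈ J
    · rw [indicator_of_notMem fun hA' => ((hA t ht).1 hA').not_ge (h1 t ht), Pi.zero_apply]
    · rw [indicator_apply_eq_zero.2 fun _ => hsupp t ht, Pi.zero_apply]
  by_cases h2 : ∀ t ∈ J, h t < 0
  · left
    have e : A.indicator (deriv g) = deriv g := by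
      refine indicator_eq_self.2 fun t ht => ?_
      have htJ : t ∈ J := by_contra fun hn => ht (hsupp t hn)
      exact (hA t htJ).2 (h2 t htJ)
    have hint : Integrable (deriv g) :=
      (hg.continuous_deriv le_rfl).integrable_of_hasCompactSupport hgc.deriv
    rw [e, ← intervalIntegral.integral_Iic_add_Ioi (b := 0) hint.integrableOn hint.integrableOn,
      hgc.integral_Iic_deriv_eq hg, hgc.integral_Ioi_deriv_eq hg, add_neg_cancel]
  push Not at h1 h2
  obtain ⟨a, haJ, ha⟩ := h1
  obtain ⟨b, hbJ, hb⟩ := h2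
  have hab : a ≤ b := (hmono.le_iff_le haJ hbJ).1 (ha.le.trans hb)
  obtain ⟨c, hc, hc0⟩ := intermediate_value_Icc hab (hcont.mono (hJ.out haJ hbJ)) ⟨ha.le, hb⟩
  have hcJ : c ∈ J := hJ.out haJ hbJ hc
  refine Or.inr ⟨c, hcJ, hc0, ?_⟩
  -- Monotonicity makes c the only sign change of h on J, and outside J the derivative vanishes, so
  -- A may be replaced by a half-line.
  have e : A.indicator (deriv g) = (Iio c).indicator (deriv g) := by
    funext t
    by_cases ht : t ∈ J
    · have : t ∈ A ↔ t ∈ Iio c := by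
        rw [hA t ht, ← hc0, hmono.lt_iff_lt ht hcJ, mem_Iio]
      by_cases htA : t ∈ A
      · rw [indicator_of_mem htA, indicator_of_mem (this.1 htA)]
      · rw [indicator_of_notMem htA, indicator_of_notMem (mt this.2 htA)]
    · rw [indicator_apply_eq_zero.2 fun _ => hsupp t ht,
        indicator_apply_eq_zero.2 fun _ => hsupp t ht]
  rw [e, integral_indicator measurableSet_Iio, ← integral_Iic_eq_integral_Iio,
    hgc.integral_Iic_deriv_eq hg]

section Slices

variable {W : Type*} [NormedAddCommGroup W] [NormedSpace ℝ W] [FiniteDimensional ℝ W]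
  [MeasurableSpace W] [BorelSpace W]

/-- Fubini's theorem along a linear splitting of the space. -/
lemma exists_integral_eq_smul_integral (μ : Measure W) [μ.IsAddHaarMeasure]
    (e : E d ≃L[ℝ] ℝ × W) :
    ∃ c : ℝ≥0, ∀ f : E d → ℝ, Integrable f → ∫ x, f x = c * ∫ w, (∫ t, f (e.symm (t, w))) ∂μ := by
  let ν : Measure (E d) := Measure.map e.symm ((volume : Measure ℝ).prod μ)
  have hν : ν.IsAddHaarMeasure := e.symm.isAddHaarMeasure_map _
  have hemb : MeasurableEmbedding e.symm := e.symm.toHomeomorph.measurableEmbedding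
  refine ⟨(volume : Measure (E d)).addHaarScalarFactor ν, fun f hf => ?_⟩
  have hfν : Integrable f ν := by
    rw [Measure.isAddLeftInvariant_eq_smul ν volume]
    exact hf.smul_measure_nnreal
  conv_lhs => rw [Measure.isAddLeftInvariant_eq_smul (volume : Measure (E d)) ν]
  rw [integral_smul_nnreal_measure, hemb.integral_map, integral_prod_symm]
  · rfl
  · exact (hemb.integrable_map_iff).1 hfν

/-- The part of a boundary that is a graph over `W` carries a finite measure dominated by the
surface measure, and this measure controls integrals of functions of the base point. -/
lemma exists_measure_of_injOn {Γ : Set (E d)} (hΓ : MeasurableSet Γ) (hb : Bornology.IsBounded Γ)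
    (π : E d →L[ℝ] W) (hinj : InjOn π Γ) {k : ℝ} (hk : 0 ≤ k)
    [(Measure.hausdorffMeasure k : Measure W).IsAddHaarMeasure] :
    ∃ ν : Measure (E d), IsFiniteMeasure ν ∧
      (∃ C : ℝ≥0∞, C ≠ ⊤ ∧ ν ≤ C • (Measure.hausdorffMeasure k).restrict Γ) ∧
      ∀ (F : E d → ℝ≥0∞) (I : W → ℝ≥0∞), Measurable F →
        (∀ w, I w = 0 ∨ ∃ p ∈ Γ, π p = w ∧ I w = F p) →
        ∫⁻ w, I w ∂(Measure.hausdorffMeasure k) ≤ ∫⁻ x, F x ∂ν := by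
  have : PolishSpace W := inferInstance
  let μ : Measure W := Measure.hausdorffMeasure k
  let j : Γ → W := fun p => π p
  have hj : MeasurableEmbedding j := ContinuousOn.measurableEmbedding hΓ π.continuous.continuousOn hinj
  -- The measure on the base is lifted to Γ, so that ν S = μ (π (Γ ∩ S)). As π is Lipschitz, it
  -- increases Hausdorff measure at most by ‖π‖^k; this replaces an area formula.
  let ν : Measure (E d) := (μ.comap j).map Subtype.val
  have hν : ∀ S, MeasurableSet S → ν S = μ (π '' (Γ ∩ S)) := fun S hS => by
    rw [Measure.map_apply measurable_subtype_coe hS, hj.comap_apply]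
    congr 1
    ext w
    constructor
    · rintro ⟨p, hp, rfl⟩
      exact ⟨p, ⟨p.2, hp⟩, rfl⟩
    · rintro ⟨p, ⟨h1, h2⟩, rfl⟩
      exact ⟨⟨p, h1⟩, h2, rfl⟩
  refine ⟨ν, ⟨?_⟩, ⟨(‖π‖₊ : ℝ≥0∞) ^ k, ?_, ?_⟩, ?_⟩
  · rw [hν _ MeasurableSet.univ, inter_univ]
    exact (π.lipschitz.isBounded_image hb).measure_lt_top
  · exact ENNReal.rpow_ne_top_of_nonneg hk ENNReal.coe_ne_top
  · refine Measure.le_iff.2 fun S hS => ?_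
    rw [hν S hS, Measure.smul_apply, Measure.restrict_apply hS, inter_comm, smul_eq_mul]
    exact π.lipschitz.hausdorffMeasure_image_le hk _
  · intro F I hF hI
    let H : W → ℝ≥0∞ := Function.extend j (fun p => F p) 0
    have hle : ∀ w, I w ≤ (range j).indicator H w := fun w => by
      rcases hI w with h | ⟨p, hp, rfl, h⟩
      · rw [h]; exact zero_le
      · have hmem : π p ∈ range j := ⟨⟨p, hp⟩, rfl⟩
        rw [h, indicator_of_mem hmem]
        exact (hj.injective.extend_apply (fun p : Γ => F p) 0 ⟨p, hp⟩).ge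
    calc ∫⁻ w, I w ∂μ ≤ ∫⁻ w, (range j).indicator H w ∂μ := lintegral_mono hle
      _ = ∫⁻ w in range j, H w ∂μ := lintegral_indicator hj.measurableSet_range _
      _ = ∫⁻ w, H w ∂(Measure.map j (μ.comap j)) := by rw [hj.map_comap]
      _ = ∫⁻ p, F p ∂(μ.comap j) := by
          rw [hj.lintegral_map]
          exact lintegral_congr fun p => hj.injective.extend_apply _ _ p
      _ = ∫⁻ x, F x ∂ν := (lintegral_map hF measurable_subtype_coe).symm

/-- In a domain bounded by a graph, the integral of a directional derivative in a transversal
direction is controlled by the boundary values. -/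
lemma exists_measure_integral_fderiv_le (hΩ : IsOpen Ω) {B : Set (E d)} (hB : IsOpen B)
    (hBc : Convex ℝ B) (hBb : Bornology.IsBounded B) {ρ : E d → ℝ} (hρ : ∀ z ∈ B, z ∈ Ω ↔ ρ z < 0)
    (hρd : ∀ z ∈ B, DifferentiableAt ℝ ρ z) (e : E d ≃L[ℝ] ℝ × W)
    (hpos : ∀ z ∈ B, 0 < fderiv ℝ ρ z (e.symm (1, 0))) {k : ℝ} (hk : 0 ≤ k)
    [(Measure.hausdorffMeasure k : Measure W).IsAddHaarMeasure] :
    ∃ ν : Measure (E d), IsFiniteMeasure ν ∧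
      (∃ C : ℝ≥0∞, C ≠ ⊤ ∧ ν ≤ C • (Measure.hausdorffMeasure k).restrict (frontier Ω)) ∧
      ∃ c : ℝ≥0∞, c ≠ ⊤ ∧ ∀ F : E d → ℝ, IsTest B F →
        ‖∫ x in Ω, fderiv ℝ F x (e.symm (1, 0))‖ₑ ≤ c * ∫⁻ x, ‖F x‖ₑ ∂ν := by
  set v := e.symm (1, 0) with hv
  let line : W → ℝ → E d := fun w t => e.symm (t, w)
  have hline : ∀ w t, HasDerivAt (line w) v t := fun w t => by
    have h1 : HasDerivAt (fun t : ℝ => ((t, w) : ℝ × W)) (1, 0) t :=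
      (hasDerivAt_id t).prodMk (hasDerivAt_const t w)
    exact (e.symm : ℝ × W →L[ℝ] E d).hasFDerivAt.comp_hasDerivAt t h1
  have hlinec : ∀ w, Continuous (line w) := fun w =>
    e.symm.continuous.comp (continuous_id.prodMk continuous_const)
  -- Convexity of B makes each slice an interval, on which ρ increases strictly; hence each line
  -- meets the frontier in B at most once, and the frontier there is a graph over W.
  let J : W → Set ℝ := fun w => line w ⁻¹' B
  have hJo : ∀ w, IsOpen (J w) := fun w => hB.preimage (hlinec w)
  have hJc : ∀ w, Convex ℝ (J w) := fun w => by
    have e1 : line w = (AffineMap.lineMap (line w 0) (line w 1) : ℝ →ᵃ[ℝ] E d) := by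
      funext t
      have : line w 1 - line w 0 = v := by
        simp only [line, ← map_sub, hv]; simp
      rw [AffineMap.lineMap_apply, vsub_eq_sub, this, vadd_eq_add, hv, ← map_smul, ← map_add]
      simp [line]
    change Convex ℝ (line w ⁻¹' B)
    rw [e1]
    exact hBc.affine_preimage _
  have hder : ∀ w, ∀ t ∈ J w, HasDerivAt (fun t => ρ (line w t)) (fderiv ℝ ρ (line w t) v) t :=
    fun w t ht => (hρd _ ht).hasFDerivAt.comp_hasDerivAt t (hline w t)
  have hcont : ∀ w, ContinuousOn (fun t => ρ (line w t)) (J w) := fun w t ht =>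
    (hder w t ht).continuousAt.continuousWithinAt
  have hmono : ∀ w, StrictMonoOn (fun t => ρ (line w t)) (J w) := fun w =>
    strictMonoOn_of_deriv_pos (hJc w) (hcont w) fun t ht => by
      rw [(hder w t (interior_subset ht)).deriv]
      exact hpos _ (interior_subset ht : t ∈ J w)
  have hπ : ∀ p, line (e p).2 (e p).1 = p := fun p => e.symm_apply_apply p
  let π : E d →L[ℝ] W := (ContinuousLinearMap.snd ℝ ℝ W) ∘L (e : E d →L[ℝ] ℝ × W)
  have hfront : ∀ p ∈ frontier Ω ∩ B, ρ p = 0 := by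
    rintro p ⟨hpf, hpB⟩
    rw [hΩ.frontier_eq] at hpf
    refine le_antisymm (not_lt.1 fun hlt => ?_) (not_lt.1 fun hlt => hpf.2 ((hρ p hpB).2 hlt))
    have hev : ∀ᶠ z in 𝓝 p, 0 < ρ z ∧ z ∈ B :=
      ((hρd p hpB).continuousAt.eventually_const_lt hlt).and (hB.mem_nhds hpB)
    obtain ⟨z, hz1, hz2⟩ := mem_closure_iff_nhds.1 hpf.1 _ hev
    exact ((hρ z hz1.2).1 hz2).not_gt hz1.1
  have hinj : InjOn π (frontier Ω ∩ B) := fun p hp q hq hpq => by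
    have hpq' : (e p).2 = (e q).2 := hpq
    have h1 : (e p).1 ∈ J (e p).2 := by change line _ _ ∈ B; rw [hπ]; exact hp.2
    have h2 : (e q).1 ∈ J (e p).2 := by change line _ _ ∈ B; rw [hpq', hπ]; exact hq.2
    have h3 : (e p).1 = (e q).1 := by
      refine (hmono (e p).2).injOn h1 h2 ?_
      rw [hπ, hpq', hπ, hfront p hp, hfront q hq]
    exact e.injective (Prod.ext h3 hpq')
  obtain ⟨ν, hνfin, ⟨C, hC, hνC⟩, hν⟩ := exists_measure_of_injOn
    (isClosed_frontier.measurableSet.inter hB.measurableSet)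
    (hBb.subset inter_subset_right) π hinj hk
  obtain ⟨c, hc⟩ := exists_integral_eq_smul_integral (Measure.hausdorffMeasure k : Measure W) e
  refine ⟨ν, hνfin, ⟨C, hC, hνC.trans ?_⟩, c, ENNReal.coe_ne_top, fun F hF => ?_⟩
  · gcongr
    exact inter_subset_left
  have hint : Integrable (Ω.indicator fun x => fderiv ℝ F x v) :=
    (memLp_one_iff_integrable.1 (hF.memLp_fderiv v 1 volume)).indicator hΩ.measurableSet
  rw [← integral_indicator hΩ.measurableSet, hc _ hint, enorm_mul]
  have hcn : ‖(c : ℝ)‖ₑ = (c : ℝ≥0∞) := by simp [enorm_eq_nnnorm]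
  rw [hcn]
  gcongr
  refine (enorm_integral_le_lintegral_enorm _).trans ?_
  refine hν (fun x => ‖F x‖ₑ) _ hF.continuous.enorm.measurable fun w => ?_
  have hgder : ∀ t, HasDerivAt (fun t => F (line w t)) (fderiv ℝ F (line w t) v) t := fun t =>
    (hF.differentiable _).hasFDerivAt.comp_hasDerivAt t (hline w t)
  have hderiv : deriv (fun t => F (line w t)) = fun t => fderiv ℝ F (line w t) v :=
    funext fun t => (hgder t).deriv
  have hgc : HasCompactSupport fun t => F (line w t) := by
    refine HasCompactSupport.intro (hF.hasCompactSupport.isCompact.image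
      (continuous_fst.comp e.continuous)) fun t ht => ?_
    by_contra hne
    refine ht ⟨line w t, subset_tsupport F hne, ?_⟩
    simp [line]
  have hg1 : ContDiff ℝ 1 fun t => F (line w t) :=
    (hF.contDiff.of_le (by simp)).comp (e.symm.contDiff.comp (contDiff_id.prodMk contDiff_const))
  have hind : (fun t => Ω.indicator (fun x => fderiv ℝ F x v) (e.symm (t, w))) =
      (line w ⁻¹' Ω).indicator (deriv fun t => F (line w t)) := by
    rw [hderiv]; rfl
  rcases integral_indicator_deriv (A := line w ⁻¹' Ω) hg1 hgc (hJc w).ordConnected (fun t ht => by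
      rw [hderiv]
      simp only [hF.fderiv_eq_zero_of_notMem ht, zero_apply])
      (hcont w) (hmono w) (fun t ht => hρ _ ht) with h | ⟨s, hsJ, hs0, h⟩
  · left
    rw [hind, h, enorm_zero]
  · right
    refine ⟨line w s, ⟨?_, hsJ⟩, ?_, by rw [hind, h]⟩
    · rw [hΩ.frontier_eq]
      refine ⟨?_, fun hmem => ((hρ _ hsJ).1 hmem).ne hs0⟩
      have hlim : Tendsto (line w) (𝓝[<] s) (𝓝 (line w s)) :=
        ((hlinec w).tendsto s).mono_left nhdsWithin_le_nhds
      refine mem_closure_of_tendsto hlim ?_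
      filter_upwards [self_mem_nhdsWithin, nhdsWithin_le_nhds ((hJo w).mem_nhds hsJ)] with t ht htJ
      exact (hρ _ htJ).2 (hs0 ▸ hmono w htJ hsJ ht)
    · change (e (e.symm (s, w))).2 = w
      rw [e.apply_symm_apply]

end Slices

/-! ### Localization and the algebra of the defect. -/

/-- A property of smooth functions that is additive and holds for functions with small support
around each point of a compact set holds for all multiples of a cutoff of that set. -/
lemma exists_cutoff {K : Set (E d)} (hK : IsCompact K) {P : (E d → ℝ) → Prop}
    (h0 : P fun _ => 0) (hadd : ∀ a b, P a → P b → P fun x => a x + b x)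
    (hloc : ∀ x ∈ K, ∃ V ∈ 𝓝 x, ∀ χ, IsTest V χ → P χ) :
    ∃ χ : E d → ℝ, ContDiff ℝ ∞ χ ∧ (∀ x ∈ K, χ x = 1) ∧
      ∀ ψ : E d → ℝ, ContDiff ℝ ∞ ψ → P fun x => χ x * ψ x := by
  refine hK.induction_on (p := fun s => ∃ χ : E d → ℝ, ContDiff ℝ ∞ χ ∧ (∀ x ∈ s, χ x = 1) ∧
      ∀ ψ : E d → ℝ, ContDiff ℝ ∞ ψ → P fun x => χ x * ψ x) ?_ ?_ ?_ ?_
  · exact ⟨fun _ => 0, contDiff_const, by simp, fun ψ _ => by simpa using h0⟩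
  · rintro s t hst ⟨χ, h1, h2, h3⟩
    exact ⟨χ, h1, fun x hx => h2 x (hst hx), h3⟩
  · rintro s t ⟨χ, h1, h2, h3⟩ ⟨θ, k1, k2, k3⟩
    -- This is 1 - (1 - χ)(1 - θ). The factor 1 - χ is absorbed into ψ, which is why the induction
    -- covers all smooth multiples.
    refine ⟨fun x => χ x + θ x * (1 - χ x), h1.add (k1.mul (contDiff_const.sub h1)), ?_, ?_⟩
    · rintro x (hx | hx)
      · simp only [h2 x hx]; ring
      · simp only [k2 x hx]; ring
    · intro ψ hψ
      have e : (fun x => (χ x + θ x * (1 - χ x)) * ψ x) =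
          fun x => χ x * ψ x + θ x * ((1 - χ x) * ψ x) := by funext x; ring
      rw [e]
      exact hadd _ _ (h3 ψ hψ) (k3 _ ((contDiff_const.sub h1).mul hψ))
  · intro x hx
    obtain ⟨V, hV, hP⟩ := hloc x hx
    obtain ⟨r, hr, hrV⟩ := Metric.nhds_basis_closedBall.mem_iff.1 hV
    let b : ContDiffBump x := ⟨r / 2, r, by positivity, by linarith⟩
    have hb : IsTest V b := ⟨b.contDiff, b.hasCompactSupport, by rw [b.tsupport_eq]; exact hrV⟩
    refine ⟨Metric.closedBall x (r / 2),
      mem_nhdsWithin_of_mem_nhds (Metric.closedBall_mem_nhds x (by positivity)), b, b.contDiff,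
      fun z hz => b.one_of_mem_closedBall hz, fun ψ hψ => hP _ (hb.mul_right hψ)⟩

lemma weakDefect_eq_integral {ψ : E d → ℝ} (h : IsTest univ ψ) (v : E d) (y : L2 Ω)
    (G : L2Vec Ω) :
    weakDefect ψ v y G = ∫ x in Ω, (y x * fderiv ℝ ψ x v + inner ℝ (G x) v * ψ x) :=
  (integral_add (h.integrable_mul_fderiv y v) (h.integrable_inner_mul G v)).symm

lemma weakDefect_add {ψ θ : E d → ℝ} (hψ : IsTest univ ψ) (hθ : IsTest univ θ) (v : E d) (y : L2 Ω)
    (G : L2Vec Ω) :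
    weakDefect (fun x => ψ x + θ x) v y G = weakDefect ψ v y G + weakDefect θ v y G := by
  rw [weakDefect_eq_integral hψ, weakDefect_eq_integral hθ, weakDefect_eq_integral (hψ.add hθ)]
  refine Eq.trans ?_ (integral_add
    ((hψ.integrable_mul_fderiv y v).add (hψ.integrable_inner_mul G v))
    ((hθ.integrable_mul_fderiv y v).add (hθ.integrable_inner_mul G v)))
  refine integral_congr_ae (ae_of_all _ fun x => ?_)
  simp only [fderiv_fun_add (hψ.differentiable x) (hθ.differentiable x), add_apply]
  ring

lemma weakDefect_sub_smul {ψ : E d → ℝ} (hψ : IsTest univ ψ) (v w : E d) (s : ℝ) (y : L2 Ω)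
    (G : L2Vec Ω) :
    weakDefect ψ (v - s • w) y G = weakDefect ψ v y G - s * weakDefect ψ w y G := by
  rw [weakDefect_eq_integral hψ, weakDefect_eq_integral hψ, weakDefect_eq_integral hψ,
    ← integral_const_mul]
  refine Eq.trans ?_ (integral_sub
    ((hψ.integrable_mul_fderiv y v).add (hψ.integrable_inner_mul G v))
    (((hψ.integrable_mul_fderiv y w).add (hψ.integrable_inner_mul G w)).const_mul s))
  refine integral_congr_ae (ae_of_all _ fun x => ?_)
  simp only [map_sub, map_smul, inner_sub_right, real_inner_smul_right, smul_eq_mul]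
  ring

/-- For smooth φ the defect is the boundary term of the divergence theorem, written as a volume
integral. -/
lemma weakDefect_toH1 {φ ψ : E d → ℝ} (hφ : IsTest univ φ) (hψ : IsTest univ ψ) (v : E d) :
    weakDefect ψ v (fn (hφ.toH1 Ω)) (grad (hφ.toH1 Ω)) =
      ∫ x in Ω, fderiv ℝ (fun x => φ x * ψ x) x v := by
  rw [weakDefect_eq_integral hψ]
  refine integral_congr_ae ?_
  filter_upwards [hφ.fn_toH1, hφ.grad_toH1] with x h1 h2
  rw [h1, h2, inner_gradient, fderiv_mul_apply hφ.differentiable hψ.differentiable]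

/-! ### Pushing into Ω, and zero extensions lie in H¹₀(Ω). -/

/-- A local defining function is nonpositive on the closure. -/
lemma defining_nonpos {V : Set (E d)} (hV : IsOpen V) {ρ : E d → ℝ} (hρc : ContinuousOn ρ V)
    (hρ : ∀ z ∈ V, z ∈ Ω ↔ ρ z < 0) {z : E d} (hz : z ∈ closure Ω) (hzV : z ∈ V) : ρ z ≤ 0 := by
  refine not_lt.1 fun hlt => ?_
  have hev : ∀ᶠ x in 𝓝 z, 0 < ρ x ∧ x ∈ V :=
    ((hρc.continuousAt (hV.mem_nhds hzV)).eventually_const_lt hlt).and (hV.mem_nhds hzV)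
  obtain ⟨x, hx1, hx2⟩ := mem_closure_iff_nhds.1 hz _ hev
  exact ((hρ x hx1.2).1 hx2).not_gt hx1.1

/-- Near each point of its closure, a smooth domain can be pushed into itself along a cone. -/
lemma exists_push (hΩ : IsSmoothBoundedOpen Ω) {x₀ : E d} (hx₀ : x₀ ∈ closure Ω) :
    ∃ V ∈ 𝓝 x₀, ∃ (w₀ : E d) (δ : ℝ), 0 < δ ∧ ∀ z ∈ closure Ω ∩ V, ∀ t ∈ Ioo 0 δ,
      ∀ w ∈ Metric.closedBall w₀ δ, z + t • w ∈ Ω := by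
  by_cases hx : x₀ ∈ Ω
  · obtain ⟨r, hr, hball⟩ := Metric.isOpen_iff.1 hΩ.isOpen x₀ hx
    refine ⟨Metric.ball x₀ (r / 2), Metric.ball_mem_nhds _ (by positivity), 0, min 1 (r / 2),
      by positivity, fun z hz t ht w hw => hball ?_⟩
    rw [mem_ball_iff_norm]
    have h1 := mem_ball_iff_norm.1 hz.2
    have h2 : ‖w‖ ≤ 1 := (mem_closedBall_zero_iff.1 hw).trans (min_le_left _ _)
    have h3 : t < r / 2 := ht.2.trans_le (min_le_right _ _)
    calc ‖z + t • w - x₀‖ = ‖(z - x₀) + t • w‖ := by congr 1; abel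
      _ ≤ ‖z - x₀‖ + t * ‖w‖ := by
          refine (norm_add_le _ _).trans ?_
          rw [norm_smul, Real.norm_of_nonneg ht.1.le]
      _ < r := by nlinarith [norm_nonneg w, ht.1]
  · have hxf : x₀ ∈ frontier Ω := hΩ.isOpen.frontier_eq ▸ ⟨hx₀, hx⟩
    obtain ⟨V, ρ, hV, hxV, hρ, hℓ, hΩV⟩ := hΩ.smooth_boundary x₀ hxf
    have hρΩ : ∀ z ∈ V, z ∈ Ω ↔ ρ z < 0 := fun z hz => by
      have := Set.ext_iff.1 hΩV z
      simpa [hz] using this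
    set ℓ := fderiv ℝ ρ x₀
    obtain ⟨v, hv⟩ : ∃ v, ℓ v = 1 := by
      obtain ⟨v, hv⟩ := DFunLike.ne_iff.1 hℓ
      exact ⟨(ℓ v)⁻¹ • v, by rw [map_smul, smul_eq_mul, inv_mul_cancel₀ hv]⟩
    have hstrict : HasStrictFDerivAt ρ ℓ x₀ :=
      (hρ.contDiffAt (hV.mem_nhds hxV)).hasStrictFDerivAt (by simp)
    -- For the admissible w below, ‖w‖ ≤ ‖v‖ + 1, so the linearization error is at most t/4, while ℓ
    -- w ≤ -1/2. Thus ρ drops by at least t/4 from a value ρ z ≤ 0.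
    have hc : (0 : ℝ) < 1 / (4 * (‖v‖ + 1)) := by positivity
    have hbound := hstrict.isLittleO.def hc
    obtain ⟨r, hr, hball⟩ := Metric.eventually_nhds_iff_ball.1
      (hbound.and ((continuous_fst.tendsto (x₀, x₀)).eventually (hV.mem_nhds hxV)))
    refine ⟨Metric.ball x₀ (r / 2) ∩ V,
      inter_mem (Metric.ball_mem_nhds _ (by positivity)) (hV.mem_nhds hxV), -v,
      -- The three bounds on δ give, in order, ‖w‖ ≤ ‖v‖ + 1, ℓ w ≤ -1/2, and z + t w in the ball of
      -- radius r.
      min 1 (min (1 / (2 * (‖ℓ‖ + 1))) (r / (2 * (‖v‖ + 1)))), by positivity,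
      fun z hz t ht w hw => ?_⟩
    set δ := min 1 (min (1 / (2 * (‖ℓ‖ + 1))) (r / (2 * (‖v‖ + 1))))
    have hδ1 : δ ≤ 1 := min_le_left _ _
    have hδ2 : δ * (2 * (‖ℓ‖ + 1)) ≤ 1 :=
      (le_div_iff₀ (by positivity)).1 ((min_le_right _ _).trans (min_le_left _ _))
    have hδ3 : δ * (2 * (‖v‖ + 1)) ≤ r :=
      (le_div_iff₀ (by positivity)).1 ((min_le_right _ _).trans (min_le_right _ _))
    have ht0 := ht.1
    have hw' : ‖w + v‖ ≤ δ := by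
      rwa [mem_closedBall_iff_norm, sub_neg_eq_add] at hw
    have hwn : ‖w‖ ≤ ‖v‖ + 1 := by
      calc ‖w‖ = ‖(w + v) - v‖ := by rw [add_sub_cancel_right]
        _ ≤ ‖w + v‖ + ‖v‖ := norm_sub_le _ _
        _ ≤ ‖v‖ + 1 := by linarith
    have hz1 := mem_ball_iff_norm.1 hz.2.1
    have hp : ‖z + t • w - x₀‖ < r := by
      calc ‖z + t • w - x₀‖ = ‖(z - x₀) + t • w‖ := by congr 1; abel
        _ ≤ ‖z - x₀‖ + t * ‖w‖ := by
            refine (norm_add_le _ _).trans ?_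
            rw [norm_smul, Real.norm_of_nonneg ht.1.le]
        _ ≤ ‖z - x₀‖ + δ * (‖v‖ + 1) := by
            have := ht.2.le
            gcongr
        _ < r := by linarith
    have hmem : (z + t • w, z) ∈ Metric.ball ((x₀, x₀) : E d × E d) r := by
      rw [← ball_prod_same]
      exact ⟨mem_ball_iff_norm.2 hp, mem_ball_iff_norm.2 (by linarith)⟩
    obtain ⟨hb, hpV⟩ := hball _ hmem
    refine (hρΩ _ hpV).2 ?_
    have hρz : ρ z ≤ 0 := defining_nonpos hV hρ.continuousOn hρΩ hz.1 hz.2.2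
    simp only [add_sub_cancel_left, map_smul, smul_eq_mul] at hb
    have hb' := (le_abs_self _).trans hb
    rw [norm_smul, Real.norm_of_nonneg ht0.le] at hb'
    have hℓw : ℓ w ≤ -1 / 2 := by
      have e1 : ℓ w = ℓ (w + v) - 1 := by rw [map_add, hv]; ring
      have e2 : ℓ (w + v) ≤ ‖ℓ‖ * ‖w + v‖ := (le_abs_self _).trans (ℓ.le_opNorm _)
      have e3 : ‖ℓ‖ * ‖w + v‖ ≤ ‖ℓ‖ * δ := by gcongr
      have e4 : 0 < δ := by positivity
      nlinarith
    have hsmall : 1 / (4 * (‖v‖ + 1)) * (t * ‖w‖) ≤ t / 4 := by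
      rw [div_mul_eq_mul_div, one_mul, div_le_iff₀ (by positivity)]
      nlinarith
    nlinarith

/-- Near each point of the closure, χy is concentrated on a compact set that can be pushed into Ω
along one cone. The pieces are summed by `exists_cutoff`, whose cutoff is 1 on the closure. -/
lemma mem_H10_of_hasZeroExtension (hΩ : IsSmoothBoundedOpen Ω) {y : H1 Ω}
    (hy : HasZeroExtension y) : y ∈ H10 Ω := by
  have hΩo := hΩ.isOpen
  have hK : IsCompact (closure Ω) := hΩ.isBounded.isCompact_closure
  have hzero : ∃ h : IsTest univ fun _ : E d => (0 : ℝ), h.mulH1 y ∈ H10 Ω := by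
    have h : IsTest (univ : Set (E d)) fun _ => 0 :=
      ⟨contDiff_const, HasCompactSupport.zero, subset_univ _⟩
    refine ⟨h, ?_⟩
    have e : fn (h.mulH1 y) = fn 0 := by
      refine Lp.ext ?_
      filter_upwards [h.fn_mulH1 y, Lp.coeFn_zero ℝ 2 (volume.restrict Ω)] with x h1 h2
      rw [h1, zero_mul]
      exact h2.symm
    rw [H1.ext_fn_grad e (grad_eq_of_fn_eq hΩo e)]
    exact (H10 Ω).zero_mem
  have hadd : ∀ a b : E d → ℝ, (∃ h : IsTest univ a, h.mulH1 y ∈ H10 Ω) →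
      (∃ h : IsTest univ b, h.mulH1 y ∈ H10 Ω) →
      ∃ h : IsTest univ fun x => a x + b x, h.mulH1 y ∈ H10 Ω := by
    rintro a b ⟨ha, ha'⟩ ⟨hb, hb'⟩
    refine ⟨ha.add hb, ?_⟩
    have e : fn ((ha.add hb).mulH1 y) = fn (ha.mulH1 y + hb.mulH1 y) := by
      rw [fn_add]
      refine Lp.ext ?_
      filter_upwards [(ha.add hb).fn_mulH1 y, ha.fn_mulH1 y, hb.fn_mulH1 y,
        Lp.coeFn_add (fn (ha.mulH1 y)) (fn (hb.mulH1 y))] with x h1 h2 h3 h4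
      rw [h1, h4, Pi.add_apply, h2, h3]; ring
    rw [H1.ext_fn_grad e (grad_eq_of_fn_eq hΩo e)]
    exact (H10 Ω).add_mem ha' hb'
  have hloc : ∀ x ∈ closure Ω, ∃ V ∈ 𝓝 x, ∀ χ, IsTest V χ →
      ∃ h : IsTest univ χ, h.mulH1 y ∈ H10 Ω := by
    intro x hx
    obtain ⟨V, hV, w₀, δ, hδ, hpush⟩ := exists_push hΩ hx
    refine ⟨V, hV, fun χ hχ => ⟨hχ.to_univ, ?_⟩⟩
    refine (hy.mulH1 hχ.to_univ).mem_H10 hΩo (K := closure Ω ∩ tsupport χ)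
      (hK.inter_right (isClosed_tsupport χ)) ?_ hδ
      fun z hz => hpush z ⟨hz.1, hχ.tsupport_subset hz.2⟩
    filter_upwards [hχ.to_univ.fn_mulH1 y, ae_restrict_mem hΩo.measurableSet] with z h1 h2 h3
    rw [h1, image_eq_zero_of_notMem_tsupport fun h => h3 ⟨subset_closure h2, h⟩, zero_mul]
  obtain ⟨χ, -, hχ1, hχ⟩ := exists_cutoff hK hzero hadd hloc
  obtain ⟨h, hmem⟩ := hχ (fun _ => 1) contDiff_const
  have e : fn (h.mulH1 y) = fn y := by
    refine Lp.ext ?_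
    filter_upwards [h.fn_mulH1 y, ae_restrict_mem hΩo.measurableSet] with x h1 h2
    rw [h1, hχ1 x (subset_closure h2)]; ring
  rwa [H1.ext_fn_grad e (grad_eq_of_fn_eq hΩo e)] at hmem

/-! ### Vanishing boundary values give a zero extension. -/

/-- Directional derivatives transversal to the boundary are controlled by boundary values. -/
lemma exists_measure_of_transversal (hΩ : IsOpen Ω) {V : Set (E d)} (hV : IsOpen V)
    {ρ : E d → ℝ} (hρ : ContDiffOn ℝ ∞ ρ V) (hρΩ : ∀ z ∈ V, z ∈ Ω ↔ ρ z < 0) {x₀ : E d}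
    (hx₀ : x₀ ∈ V) {v : E d} (hv : fderiv ℝ ρ x₀ v = 1) :
    ∃ B ∈ 𝓝 x₀, ∃ ν : Measure (E d), IsFiniteMeasure ν ∧
      (∃ C : ℝ≥0∞, C ≠ ⊤ ∧ ν ≤ C • surface Ω) ∧
      ∃ c : ℝ≥0∞, c ≠ ⊤ ∧ ∀ F : E d → ℝ, IsTest B F →
        ‖∫ x in Ω, fderiv ℝ F x v‖ₑ ≤ c * ∫⁻ x, ‖F x‖ₑ ∂ν := by
  set ℓ := fderiv ℝ ρ x₀
  have hcont : ContinuousAt (fun z => fderiv ℝ ρ z v) x₀ :=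
    ((hρ.continuousOn_fderiv_of_isOpen hV (by simp)).continuousAt
      (hV.mem_nhds hx₀)).clm_apply continuousAt_const
  have hev : ∀ᶠ z in 𝓝 x₀, 0 < fderiv ℝ ρ z v ∧ z ∈ V :=
    (hcont.eventually_const_lt (one_pos.trans_eq hv.symm)).and (hV.mem_nhds hx₀)
  obtain ⟨r, hr, hball⟩ := Metric.eventually_nhds_iff_ball.1 hev
  -- Space splits as ℝ v ⊕ ker ℓ. The kernel has dimension d - 1, so its Haar measure is a Hausdorff
  -- measure of the same dimension as `surface`.
  let e := ContinuousLinearEquiv.equivOfRightInverse ℓ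
    (ContinuousLinearMap.toSpanSingleton ℝ v) fun t => by simp [hv]
  have he : e.symm (1, 0) = v := by
    rw [ContinuousLinearEquiv.equivOfRightInverse_symm_apply]; simp
  have hℓ0 : (ℓ : E d →ₗ[ℝ] ℝ) ≠ 0 := fun h => by
    have : (ℓ : E d →ₗ[ℝ] ℝ) v = 0 := by rw [h]; rfl
    exact one_ne_zero (hv.symm.trans this)
  have hk : ((Module.finrank ℝ (LinearMap.ker (ℓ : E d →ₗ[ℝ] ℝ)) : ℕ) : ℝ) = (d : ℝ) - 1 := by
    have h1 := Module.Dual.finrank_ker_add_one_of_ne_zero (f := (ℓ : E d →ₗ[ℝ] ℝ)) hℓ0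
    rw [finrank_euclideanSpace_fin] at h1
    rw [eq_sub_iff_add_eq]
    exact_mod_cast h1
  have hpos : ∀ z ∈ Metric.ball x₀ r, 0 < fderiv ℝ ρ z (e.symm (1, 0)) := fun z hz => by
    rw [he]; exact (hball z hz).1
  obtain ⟨ν, hν, hC, hc⟩ := exists_measure_integral_fderiv_le hΩ Metric.isOpen_ball
    (convex_ball x₀ r) Metric.isBounded_ball (fun z hz => hρΩ z (hball z hz).2)
    (fun z hz => (hρ.differentiableOn (by simp)).differentiableAt (hV.mem_nhds (hball z hz).2))
    e hpos (Nat.cast_nonneg (Module.finrank ℝ (LinearMap.ker (ℓ : E d →ₗ[ℝ] ℝ))))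
  rw [he] at hc
  rw [hk] at hC
  exact ⟨_, Metric.ball_mem_nhds x₀ hr, ν, hν, hC, hc⟩

/-- If the boundary values of the approximating functions vanish in the limit, the limit satisfies
the integration by parts formula against functions supported where derivatives are controlled. -/
lemma weakDefect_eq_zero_of_tendsto {φ : ℕ → E d → ℝ} (hφ : ∀ n, IsTest univ (φ n)) {y : H1 Ω}
    (hy : Tendsto (fun n => (hφ n).toH1 Ω) atTop (𝓝 y))
    (h0 : Tendsto (fun n => eLpNorm (φ n) 2 (surface Ω)) atTop (𝓝 0)) {B : Set (E d)} {v : E d}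
    {ν : Measure (E d)} [IsFiniteMeasure ν] {C : ℝ≥0∞} (hC : C ≠ ⊤) (hν : ν ≤ C • surface Ω)
    {c : ℝ≥0∞} (hc : c ≠ ⊤)
    (hF : ∀ F : E d → ℝ, IsTest B F → ‖∫ x in Ω, fderiv ℝ F x v‖ₑ ≤ c * ∫⁻ x, ‖F x‖ₑ ∂ν)
    {ψ : E d → ℝ} (hψ : IsTest B ψ) : weakDefect ψ v (fn y) (grad y) = 0 := by
  have hlim : Tendsto (fun n => weakDefect ψ v (fn ((hφ n).toH1 Ω)) (grad ((hφ n).toH1 Ω))) atTop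
      (𝓝 (weakDefect ψ v (fn y) (grad y))) :=
    (((continuous_weakDefect hψ.to_univ v).comp continuous_subtype_val).tendsto y).comp hy
  obtain ⟨M, hM⟩ := hψ.continuous.bounded_above_of_compact_support hψ.hasCompactSupport
  -- The factors come from the slicing bound, from sup |ψ|, from ν ≤ C • `surface Ω`, and from L² ⊂
  -- L¹ for the finite measure ν.
  let D : ℝ≥0∞ := c * (ENNReal.ofReal M *
    ((C ^ (1 / (2 : ℝ≥0∞)).toReal) * ν univ ^ (1 / (1 : ℝ≥0∞).toReal - 1 / (2 : ℝ≥0∞).toReal)))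
  have hD : D ≠ ⊤ := by
    refine ENNReal.mul_ne_top hc (ENNReal.mul_ne_top ENNReal.ofReal_ne_top
      (ENNReal.mul_ne_top (ENNReal.rpow_ne_top_of_nonneg ENNReal.toReal_nonneg hC)
        (ENNReal.rpow_ne_top_of_nonneg (by norm_num) (measure_ne_top ν univ))))
  have hle : ∀ n, ‖weakDefect ψ v (fn ((hφ n).toH1 Ω)) (grad ((hφ n).toH1 Ω))‖ₑ ≤
      D * eLpNorm (φ n) 2 (surface Ω) := fun n => by
    rw [weakDefect_toH1 (hφ n) hψ.to_univ]
    refine (hF _ (hψ.mul_left (hφ n).contDiff)).trans ?_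
    have h1 : ∫⁻ x, ‖φ n x * ψ x‖ₑ ∂ν ≤ ENNReal.ofReal M * eLpNorm (φ n) 1 ν := by
      rw [eLpNorm_one_eq_lintegral_enorm, ← lintegral_const_mul _
        (hφ n).continuous.enorm.measurable]
      refine lintegral_mono fun x => ?_
      rw [enorm_mul, mul_comm]
      gcongr
      rw [← ofReal_norm]
      exact ENNReal.ofReal_le_ofReal (hM x)
    have h2 : eLpNorm (φ n) 1 ν ≤ eLpNorm (φ n) 2 ν *
        ν univ ^ (1 / (1 : ℝ≥0∞).toReal - 1 / (2 : ℝ≥0∞).toReal) :=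
      eLpNorm_le_eLpNorm_mul_rpow_measure_univ (by norm_num)
        (hφ n).continuous.aestronglyMeasurable
    have h3 : eLpNorm (φ n) 2 ν ≤ C ^ (1 / (2 : ℝ≥0∞)).toReal * eLpNorm (φ n) 2 (surface Ω) :=
      eLpNorm_le_of_measure_le_smul hν
    calc c * ∫⁻ x, ‖φ n x * ψ x‖ₑ ∂ν
        ≤ c * (ENNReal.ofReal M * ((C ^ (1 / (2 : ℝ≥0∞)).toReal * eLpNorm (φ n) 2 (surface Ω)) *
          ν univ ^ (1 / (1 : ℝ≥0∞).toReal - 1 / (2 : ℝ≥0∞).toReal))) := by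
          gcongr
          refine h1.trans ?_
          gcongr
          exact h2.trans (by gcongr)
      _ = D * eLpNorm (φ n) 2 (surface Ω) := by simp only [D]; ring
  have hz : Tendsto (fun n => ‖weakDefect ψ v (fn ((hφ n).toH1 Ω)) (grad ((hφ n).toH1 Ω))‖ₑ) atTop
      (𝓝 0) := by
    refine tendsto_of_tendsto_of_tendsto_of_le_of_le tendsto_const_nhds ?_ (fun _ => zero_le) hle
    simpa using ENNReal.Tendsto.const_mul h0 (Or.inr hD)
  have := tendsto_nhds_unique hz hlim.enorm
  exact enorm_eq_zero.1 this.symm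

/-- A limit of smooth functions whose boundary values tend to zero has a zero extension. -/
lemma hasZeroExtension_of_tendsto (hΩ : IsSmoothBoundedOpen Ω) {φ : ℕ → E d → ℝ}
    (hφ : ∀ n, IsTest univ (φ n)) {y : H1 Ω}
    (hy : Tendsto (fun n => (hφ n).toH1 Ω) atTop (𝓝 y))
    (h0 : Tendsto (fun n => eLpNorm (φ n) 2 (surface Ω)) atTop (𝓝 0)) : HasZeroExtension y := by
  intro ψ hψ v
  have hΩo := hΩ.isOpen
  let P : (E d → ℝ) → Prop := fun χ => IsTest univ χ ∧ weakDefect χ v (fn y) (grad y) = 0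
  have hzero : P fun _ => 0 :=
    ⟨⟨contDiff_const, HasCompactSupport.zero, subset_univ _⟩, by simp [weakDefect]⟩
  have hadd : ∀ a b, P a → P b → P fun x => a x + b x := fun a b ha hb =>
    ⟨ha.1.add hb.1, by rw [weakDefect_add ha.1 hb.1, ha.2, hb.2, add_zero]⟩
  have hloc : ∀ x ∈ closure Ω, ∃ V ∈ 𝓝 x, ∀ χ, IsTest V χ → P χ := by
    intro x hx
    by_cases hxΩ : x ∈ Ω
    · exact ⟨Ω, hΩo.mem_nhds hxΩ, fun χ hχ =>
        ⟨hχ.to_univ, isWeakGradient_iff.1 y.2 χ hχ v⟩⟩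
    obtain ⟨V, ρ, hV, hxV, hρ, hℓ, hΩV⟩ :=
      hΩ.smooth_boundary x (hΩo.frontier_eq ▸ ⟨hx, hxΩ⟩)
    have hρΩ : ∀ z ∈ V, z ∈ Ω ↔ ρ z < 0 := fun z hz => by
      have := Set.ext_iff.1 hΩV z
      simpa [hz] using this
    obtain ⟨w, hw⟩ : ∃ w, fderiv ℝ ρ x w = 1 := by
      obtain ⟨w, hw⟩ := DFunLike.ne_iff.1 hℓ
      exact ⟨(fderiv ℝ ρ x w)⁻¹ • w, by rw [map_smul, smul_eq_mul, inv_mul_cancel₀ hw]⟩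
    -- The direction v may be tangential. This s makes v + s w transversal, and v = (v + s w) - s w
    -- is a combination of two transversal directions.
    set s := 1 - fderiv ℝ ρ x v with hs
    have hw' : fderiv ℝ ρ x (v + s • w) = 1 := by
      rw [map_add, map_smul, hw, hs, smul_eq_mul]; ring
    obtain ⟨B₁, hB₁, ν₁, hν₁, ⟨C₁, hC₁, hνC₁⟩, c₁, hc₁, h₁⟩ :=
      exists_measure_of_transversal hΩo hV hρ hρΩ hxV hw
    obtain ⟨B₂, hB₂, ν₂, hν₂, ⟨C₂, hC₂, hνC₂⟩, c₂, hc₂, h₂⟩ :=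
      exists_measure_of_transversal hΩo hV hρ hρΩ hxV hw'
    refine ⟨B₁ ∩ B₂, inter_mem hB₁ hB₂, fun χ hχ => ⟨hχ.to_univ, ?_⟩⟩
    have hχ₁ : IsTest B₁ χ :=
      ⟨hχ.contDiff, hχ.hasCompactSupport, hχ.tsupport_subset.trans inter_subset_left⟩
    have hχ₂ : IsTest B₂ χ :=
      ⟨hχ.contDiff, hχ.hasCompactSupport, hχ.tsupport_subset.trans inter_subset_right⟩
    have e : v = (v + s • w) - s • w := by rw [add_sub_cancel_right]
    rw [e, weakDefect_sub_smul hχ.to_univ,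
      weakDefect_eq_zero_of_tendsto hφ hy h0 hC₁ hνC₁ hc₁ h₁ hχ₁,
      weakDefect_eq_zero_of_tendsto hφ hy h0 hC₂ hνC₂ hc₂ h₂ hχ₂, mul_zero, sub_zero]
  obtain ⟨χ, -, hχ1, hχ⟩ := exists_cutoff hΩ.isBounded.isCompact_closure hzero hadd hloc
  obtain ⟨hχψ, hχ0⟩ := hχ ψ hψ.contDiff
  -- As χ = 1 on the closure of Ω, χψ and ψ agree near every point of Ω and have the same defect.
  rw [← hχ0, weakDefect_eq_integral hψ, weakDefect_eq_integral hχψ]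
  refine setIntegral_congr_fun hΩo.measurableSet fun x hx => ?_
  have heq : (fun x => χ x * ψ x) =ᶠ[𝓝 x] ψ := by
    filter_upwards [hΩo.mem_nhds hx] with z hz
    rw [hχ1 z (subset_closure hz), one_mul]
  simp only [heq.fderiv_eq, hχ1 x (subset_closure hx), one_mul]

/-- Functions in `H¹(Ω)` with the same trace differ by an element of `H¹₀(Ω)`. -/
lemma HasTrace.sub_mem_H10 (hΩ : IsSmoothBoundedOpen Ω) {y z : H1 Ω} {g : L2Bdry Ω}
    (hy : HasTrace y g) (hz : HasTrace z g) : y - z ∈ H10 Ω := by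
  obtain ⟨φ, hφ, hlim, h0⟩ := hy.exists_tendsto_sub hΩ.isOpen hz
  exact mem_H10_of_hasZeroExtension hΩ (hasZeroExtension_of_tendsto hΩ hφ hlim h0)

end

end Conductivity

theorem mainTheorem8 {d : ℕ} (hd : 1 ≤ d) {Ω : Set (Conductivity.E d)}
    (hΩ : Conductivity.IsSmoothBoundedOpen Ω)
    (F : Submodule ℝ (Conductivity.LInf Ω)) {m M : ℝ} (hm : 0 < m) (hmM : m < M)
    (f : Conductivity.HNeg1 Ω) (g : Conductivity.L2Bdry Ω) (hg : Conductivity.MemH12 g) :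
    ∃ S : Conductivity.U F m M → Conductivity.H1 Ω,
      (∀ (u : Conductivity.U F m M) (y : Conductivity.H1 Ω),
        Conductivity.IsSolution (u : Conductivity.LInf Ω) f g y ↔ y = S u) ∧
      (∀ u₁ u₂ : Conductivity.U F m M,
        S u₁ - S u₂ ∈ Conductivity.H10 Ω ∧
        Conductivity.h10Norm (S u₁ - S u₂) ≤
          1 / m ^ 2 * ‖(u₁ : Conductivity.LInf Ω) - (u₂ : Conductivity.LInf Ω)‖ *
            (Conductivity.hNeg1Norm f + M * Conductivity.h12Norm g)) ∧
      ∃ K : ℝ≥0, LipschitzWith K S :=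
  Conductivity.exists_solution_map hd hΩ.isOpen hΩ.isBounded
    (fun hy hz => hy.sub_mem_H10 hΩ hz) F hm hmM.le f g hg
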